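/- There is a universal constant $c\in\mathbb{N}$ such that the following holds. Let $q\ge 4$ be a prime power, let $H=\mathrm{SL}(2,q)$ be the group of $2\times 2$ matrices of determinant $1$ over the field with $q$ elements, and let $m\ge 3$. Let $p$ be a $3$-uniform probability distribution on $H^m$, that is, for any $3$ distinct coordinates the marginal of $p$ on these coordinates is the uniform distribution on $H^3$. Then the convolution of $m^c$ independent copies of $p$ (the distribution of the coordinatewise product $x_1x_2\cdots x_{m^c}$ of independent samples $x_i$ from $p$) is $|H|^{-m}$-uniform on $H^m$: it assigns to each $x\in H^m$ a probability $P(x)$ with $$\Bigl|P(x)-\frac{1}{|H|^m}\Bigr|\le \frac{|H|^{-m}}{|H|^m}.$$ -/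

import Mathlib

open scoped MatrixGroups

noncomputable section

/-- The convolution of two distributions on a group: the law of `x * y` where `x` is sampled
from `p` and, independently, `y` is sampled from `q`. -/
def PMF.groupConv {G : Type*} [Group G] (p q : PMF G) : PMF G :=
  p.bind fun x => q.map fun y => x * y

/-- The convolution of `n` independent copies of `p`
(for `n = 0` the point mass at the identity). -/
def PMF.groupConvPow {G : Type*} [Group G] (p : PMF G) : ℕ → PMF G
  | 0 => PMF.pure 1
  | n + 1 => (PMF.groupConvPow p n).groupConv p

/-- A distribution `p` on a finite set `S` is `ε`-uniform if `|p x - 1/|S|| ≤ ε/|S|` for all `x`. -/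
def PMF.IsEpsUniform {S : Type*} (ε : ℝ) (p : PMF S) : Prop :=
  ∀ x : S, |(p x).toReal - 1 / (Nat.card S : ℝ)| ≤ ε / (Nat.card S : ℝ)

/-- A distribution `p` on `H ^ t` is `(ε, k)`-uniform, where `k ≤ t`, if its marginal on any `k`
coordinates is `ε`-uniform. -/
def PMF.IsEpsKUniform {H : Type*} {t : ℕ} (ε : ℝ) (k : ℕ) (p : PMF (Fin t → H)) : Prop :=
  k ≤ t ∧ ∀ I : Finset (Fin t), I.card = k →
    PMF.IsEpsUniform ε (p.map fun (x : Fin t → H) (i : I) => x i)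

/-- A distribution on `H ^ t` is `k`-uniform if it is `(0, k)`-uniform. -/
def PMF.IsKUniform {H : Type*} {t : ℕ} (k : ℕ) (p : PMF (Fin t → H)) : Prop :=
  PMF.IsEpsKUniform 0 k p

end

/-! The proof is Fourier analysis on $H^m$. By Fourier inversion (`abs_marginal_sub_le`) a marginal
on $k$ coordinates has relative error at most $|H|^k$ times a bound for its nontrivial Fourier
coefficients, and convolution multiplies coefficients. So it suffices that every coefficient with
$s$ nontrivial tensor factors, of norm $t$ say, satisfies $t^{s^{33}}\le |H|^{-1}$; this is
`norm_repMean_pow_le`.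

That bound is proved by strong induction on $s$. For $s\le 3$ the coefficients vanish by
3-uniformity. For $s>3$ the coordinates are cut into three blocks, any two of which cover at most
$4s/5$ coordinates. By induction a suitable convolution power $r$ of (reversed $p$) * $p$ has
marginals on pairs of blocks at most $9/8$ times uniform. The analytic core,
`norm_sum_smul_pow_four_le`, turns bounded pair marginals into smallness on all three blocks: two
Cauchy–Schwarz steps decouple the blocks, and Schur orthogonality gains the dimension $d$ of the
representation on one block.

Quasirandomness enters here: nontrivial representations of $\mathrm{SL}(2,q)$ have dimension at
least $(q-1)/2$, so $d$ is at least a fixed power of $|H|$ raised to the block size. Returning from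
$r$ to $p$ costs a factor 576 in the exponent, which the shrinking of $s$ by $4/5$ repays, as
$(5/4)^{33}>576$. -/

open Finset
open scoped Matrix
open scoped Matrix.Norms.L2Operator

/-! ### Schur orthogonality and unitarization. -/

/-- A unitary matrix representation of a finite group whose matrix coefficients satisfy the
Schur orthogonality relations. -/
structure IsSchurRep {G n : Type*} [Group G] [Fintype G] [Fintype n] [DecidableEq n]
    (ρ : G →* Matrix n n ℂ) : Prop where
  conjTranspose_apply : ∀ g, (ρ g)ᴴ = ρ g⁻¹
  sum_mul_star : ∀ i j k l, ∑ g, ρ g i j * star (ρ g k l) =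
    if i = k ∧ j = l then (Fintype.card G : ℂ) / Fintype.card n else 0

namespace IsSchurRep

variable {G n : Type*} [Group G] [Fintype G] [Fintype n] [DecidableEq n] {ρ : G →* Matrix n n ℂ}

theorem sum_conj (h : IsSchurRep ρ) (M : Matrix n n ℂ) :
    ∑ g, ρ g * M * (ρ g)ᴴ = ((Fintype.card G : ℂ) / Fintype.card n * M.trace) • 1 := by
  ext i k
  have : (∑ g, ρ g * M * (ρ g)ᴴ) i k = ∑ l, ∑ j, M j l * ∑ g, ρ g i j * star (ρ g k l) := by
    simp only [Matrix.sum_apply, Matrix.mul_apply, Finset.sum_mul,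
      Finset.mul_sum]
    rw [Finset.sum_comm]
    refine sum_congr rfl fun l _ => ?_
    rw [Finset.sum_comm]
    refine sum_congr rfl fun j _ => sum_congr rfl fun g _ => ?_
    simp only [Matrix.conjTranspose_apply]
    ring
  rw [this]
  simp only [h.sum_mul_star, Matrix.smul_apply, Matrix.one_apply, Matrix.trace, Matrix.diag, smul_eq_mul]
  by_cases hik : i = k
  · subst hik
    simp [Finset.mul_sum, mul_comm]
  · simp [hik]

/-- A nontrivial Schur representation has no invariants. -/
theorem sum_eq_zero (h : IsSchurRep ρ) (hρ : ρ ≠ 1) : ∑ g, ρ g = 0 := by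
  set P := ∑ g, ρ g with hP
  have hl : ∀ g, ρ g * P = P := fun g => by
    rw [hP, Finset.mul_sum]
    simp_rw [← map_mul]
    exact Fintype.sum_equiv (Equiv.mulLeft g) _ _ fun _ => rfl
  have hr : ∀ g, P * (ρ g)ᴴ = P := fun g => by
    rw [hP, Finset.sum_mul, h.conjTranspose_apply]
    simp_rw [← map_mul]
    exact Fintype.sum_equiv (Equiv.mulRight g⁻¹) _ _ fun _ => rfl
  -- Since `P` is fixed by conjugation, `sum_conj` makes a multiple of it scalar. A nonzero scalar
  -- absorbing every `ρ g` would force `ρ = 1`.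
  have hs := h.sum_conj P
  simp only [hl, hr, sum_const, card_univ] at hs
  set c := (Fintype.card G : ℂ) / Fintype.card n * P.trace
  by_cases hc : c = 0
  · rw [hc, zero_smul, ← Nat.cast_smul_eq_nsmul ℂ, smul_eq_zero] at hs
    exact hs.resolve_left (Nat.cast_ne_zero.2 Fintype.card_ne_zero)
  · refine absurd (MonoidHom.ext fun g => ?_) hρ
    have h2 : ρ g * (Fintype.card G • P) = Fintype.card G • P := by
      rw [mul_smul_comm, hl]
    rw [hs, mul_smul_comm, mul_one] at h2
    exact smul_right_injective _ hc h2

/-- The matrix coefficients of a representation spanning the full matrix algebra are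
orthogonal. -/
theorem of_span (hU : ∀ g, (ρ g)ᴴ = ρ g⁻¹) (hS : Submodule.span ℂ (Set.range ρ) = ⊤)
    [Nonempty n] : IsSchurRep ρ := by
  refine ⟨hU, fun i j k l => ?_⟩
  -- The averaged matrix unit commutes with every `ρ g`, hence with the whole matrix algebra, so it
  -- is scalar. Its trace determines the scalar, and its entry `(i, k)` is the sum sought.
  set A := ∑ g, ρ g * Matrix.single j l (1 : ℂ) * (ρ g)ᴴ with hA
  have hcomm : ∀ M : Matrix n n ℂ, Commute A M := by
    intro M
    have hM : M ∈ Submodule.span ℂ (Set.range ρ) := hS ▸ Submodule.mem_top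
    induction hM using Submodule.span_induction with
    | mem x hx =>
      obtain ⟨g, rfl⟩ := hx
      change A * ρ g = ρ g * A
      rw [hA, Finset.sum_mul, Finset.mul_sum]
      refine (Fintype.sum_equiv (Equiv.mulLeft g) _ _ fun x => ?_).symm
      rw [Equiv.coe_mulLeft, hU, hU]
      simp only [mul_assoc, ← map_mul, mul_inv_rev, inv_mul_cancel, mul_one]
      simp only [map_mul, mul_assoc]
    | zero => exact Commute.zero_right _
    | add x y _ _ hx hy => exact hx.add_right hy
    | smul a x _ hx => exact hx.smul_right a
  obtain ⟨c, hc⟩ : ∃ c : ℂ, A = c • 1 := by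
    obtain ⟨c, hc⟩ := (Matrix.mem_range_scalar_iff_commute_single' (M := A)).2
      fun i j => (hcomm _).symm
    exact ⟨c, by rw [← hc, Matrix.scalar_apply, Matrix.smul_one_eq_diagonal]⟩
  have hcn : c * Fintype.card n = if j = l then (Fintype.card G : ℂ) else 0 := by
    have h1 : A.trace = c * Fintype.card n := by rw [hc]; simp
    rw [← h1, hA, Matrix.trace_sum]
    have : ∀ g, (ρ g * Matrix.single j l (1 : ℂ) * (ρ g)ᴴ).trace = if j = l then 1 else 0 := by
      intro g
      rw [Matrix.trace_mul_comm, ← mul_assoc, hU, ← map_mul]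
      simp only [inv_mul_cancel, map_one, one_mul]
      split_ifs with h
      · subst h; simp
      · exact Matrix.trace_single_eq_of_ne _ _ _ h
    simp [this]
  have hAik : A i k = ∑ g, ρ g i j * star (ρ g k l) := by
    rw [hA, Matrix.sum_apply]
    refine sum_congr rfl fun g _ => ?_
    simp [Matrix.mul_apply, Matrix.single_apply, ite_and]
  have hn : (Fintype.card n : ℂ) ≠ 0 := Nat.cast_ne_zero.2 Fintype.card_ne_zero
  rw [← hAik, hc, Matrix.smul_apply, Matrix.one_apply, smul_eq_mul, eq_div_of_mul_eq hn hcn]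
  split_ifs <;> simp_all

end IsSchurRep

open scoped ComplexOrder MatrixOrder Matrix.Norms.L2Operator in
/-- A matrix representation spanning the matrix algebra is similar to a Schur representation. -/
theorem exists_isSchurRep_of_span {G n : Type*} [Group G] [Fintype G] [Fintype n] [DecidableEq n]
    [Nonempty n] (σ : G →* Matrix n n ℂ) (hS : Submodule.span ℂ (Set.range σ) = ⊤) :
    ∃ ρ : G →* Matrix n n ℂ, IsSchurRep ρ ∧ ∀ g, (ρ g).trace = (σ g).trace := by
  -- Weyl's unitary trick: this positive definite form is invariant, and conjugating by a factor `B`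
  -- with form `Bᴴ * B` makes the representation unitary.
  have hpos : (∑ g, (σ g)ᴴ * σ g).PosDef := by
    refine Matrix.posDef_sum univ_nonempty fun g _ => ?_
    refine Matrix.PosDef.conjTranspose_mul_self _ (Matrix.mulVec_injective_of_isUnit ?_)
    exact (Group.isUnit g).map σ
  obtain ⟨B, hB⟩ : ∃ B : Matrix n n ℂ, ∑ g, (σ g)ᴴ * σ g = Bᴴ * B := by
    exact CStarAlgebra.nonneg_iff_eq_star_mul_self.mp hpos.posSemidef.nonneg
  have hBu : IsUnit B := by
    have h1 := hpos.isUnit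
    rw [hB] at h1
    rw [Matrix.isUnit_iff_isUnit_det, Matrix.det_mul] at h1
    exact (Matrix.isUnit_iff_isUnit_det B).2 (isUnit_of_mul_isUnit_right h1)
  obtain ⟨u, rfl⟩ := hBu
  have hinv : ∀ g, (σ g)ᴴ * ((u : Matrix n n ℂ)ᴴ * u) * σ g = (u : Matrix n n ℂ)ᴴ * u := by
    intro g
    rw [← hB, Finset.mul_sum, Finset.sum_mul]
    refine Fintype.sum_equiv (Equiv.mulRight g) _ _ fun x => ?_
    simp [map_mul, Matrix.conjTranspose_mul, mul_assoc]
  let ρ : G →* Matrix n n ℂ :=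
    { toFun g := u * σ g * (u⁻¹ : (Matrix n n ℂ)ˣ)
      map_one' := by simp
      map_mul' x y := by simp [mul_assoc] }
  have hρ : ∀ g, ρ g = u * σ g * (u⁻¹ : (Matrix n n ℂ)ˣ) := fun _ => rfl
  refine ⟨ρ, IsSchurRep.of_span (fun g => ?_) ?_, fun g => ?_⟩
  · have h1 : (ρ g)ᴴ * ρ g = 1 := by
      have h2 : ((u⁻¹ : (Matrix n n ℂ)ˣ) : Matrix n n ℂ)ᴴ * (u : Matrix n n ℂ)ᴴ = 1 := by
        rw [← Matrix.conjTranspose_mul]; simp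
      calc (ρ g)ᴴ * ρ g = ((u⁻¹ : (Matrix n n ℂ)ˣ) : Matrix n n ℂ)ᴴ *
            ((σ g)ᴴ * ((u : Matrix n n ℂ)ᴴ * u) * σ g) * (u⁻¹ : (Matrix n n ℂ)ˣ) := by
            simp only [hρ, Matrix.conjTranspose_mul, mul_assoc]
        _ = 1 := by
            rw [hinv, ← mul_assoc, h2]; simp
    calc (ρ g)ᴴ = (ρ g)ᴴ * (ρ g * ρ g⁻¹) := by rw [← map_mul]; simp
      _ = ρ g⁻¹ := by rw [← mul_assoc, h1, one_mul]
  · rw [eq_top_iff]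
    intro M _
    have hM : (u⁻¹ : (Matrix n n ℂ)ˣ) * M * u ∈ Submodule.span ℂ (Set.range σ) :=
      hS ▸ Submodule.mem_top
    have key : ∀ X ∈ Submodule.span ℂ (Set.range σ),
        u * X * (u⁻¹ : (Matrix n n ℂ)ˣ) ∈ Submodule.span ℂ (Set.range ρ) := by
      intro X hX
      induction hX using Submodule.span_induction with
      | mem x hx => obtain ⟨g, rfl⟩ := hx; exact Submodule.subset_span ⟨g, rfl⟩
      | zero => simp
      | add x y _ _ hx hy => rw [mul_add, add_mul]; exact add_mem hx hy
      | smul a x _ hx => rw [mul_smul_comm, smul_mul_assoc]; exact Submodule.smul_mem _ _ hx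
    have := key _ hM
    simpa [mul_assoc] using this
  · rw [hρ, Matrix.trace_mul_comm, ← mul_assoc]; simp

/-! ### Decomposition of the regular character. -/

theorem trace_mulLeft_pi_matrix {ι : Type*} [Fintype ι] [DecidableEq ι] {d : ι → ℕ}
    (A : ∀ i, Matrix (Fin (d i)) (Fin (d i)) ℂ) :
    LinearMap.trace ℂ _ (LinearMap.mulLeft ℂ A) = ∑ i, (d i : ℂ) * (A i).trace := by
  let b := Pi.basis fun i => Matrix.stdBasis ℂ (Fin (d i)) (Fin (d i))
  rw [LinearMap.trace_eq_matrix_trace ℂ b, Matrix.trace, Fintype.sum_sigma]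
  refine sum_congr rfl fun i _ => ?_
  have : ∀ x y, (LinearMap.toMatrix b b (LinearMap.mulLeft ℂ A)).diag ⟨i, (x, y)⟩ = A i x x := by
    intro x y
    rw [Matrix.diag, LinearMap.toMatrix_apply, Pi.basis_apply, Pi.basis_repr,
      Matrix.stdBasis_eq_single]
    simp [Matrix.stdBasis]
  have h2 : ∑ x : Fin (d i), ∑ _y : Fin (d i), A i x x = d i * (A i).trace := by
    simp [Matrix.trace, Finset.mul_sum]
  rw [← h2, Fintype.sum_prod_type]
  exact sum_congr rfl fun x _ => sum_congr rfl fun y _ => this x y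

theorem trace_mulLeft_monoidAlgebra {G : Type*} [Group G] [Fintype G] [DecidableEq G] (g : G) :
    LinearMap.trace ℂ _ (LinearMap.mulLeft ℂ (MonoidAlgebra.of ℂ G g)) =
      if g = 1 then (Fintype.card G : ℂ) else 0 := by
  let b := MonoidAlgebra.basis G ℂ
  rw [LinearMap.trace_eq_matrix_trace ℂ b, Matrix.trace]
  have : ∀ x, (LinearMap.toMatrix b b (LinearMap.mulLeft ℂ (MonoidAlgebra.of ℂ G g))).diag x =
      if g = 1 then 1 else 0 := by
    intro x
    rw [Matrix.diag, LinearMap.toMatrix_apply]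
    simp only [MonoidAlgebra.of_apply, LinearMap.mulLeft_apply, b, MonoidAlgebra.basis_apply,
      MonoidAlgebra.single_mul_single, mul_one]
    rw [← MonoidAlgebra.basis_apply, Module.Basis.repr_self, Finsupp.single_apply]
    simp
  rw [sum_congr rfl fun x _ => this x]
  simp

/-- The regular character of a finite group is a sum of characters of Schur representations. -/
theorem exists_isSchurRep_sum_trace (G : Type*) [Group G] [Fintype G] [DecidableEq G] :
    ∃ (N : ℕ) (n : Fin N → ℕ) (ρ : ∀ j, G →* Matrix (Fin (n j)) (Fin (n j)) ℂ),
      (∀ j, 0 < n j) ∧ (∀ j, IsSchurRep (ρ j)) ∧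
      ∀ g, ∑ j, (ρ j g).trace = if g = 1 then (Fintype.card G : ℂ) else 0 := by
  obtain ⟨N, d, hd, ⟨e⟩⟩ :=
    IsSemisimpleRing.exists_algEquiv_pi_matrix_of_isAlgClosed ℂ (MonoidAlgebra ℂ G)
  let σ : ∀ i, G →* Matrix (Fin (d i)) (Fin (d i)) ℂ := fun i =>
    (((Pi.evalAlgHom ℂ (fun i => Matrix (Fin (d i)) (Fin (d i)) ℂ) i).comp
      e.toAlgHom : MonoidAlgebra ℂ G →ₐ[ℂ] _) : MonoidAlgebra ℂ G →* _).comp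
        (MonoidAlgebra.of ℂ G)
  have hσ : ∀ i, Submodule.span ℂ (Set.range (σ i)) = ⊤ := by
    intro i
    rw [eq_top_iff]
    intro M _
    obtain ⟨x, hx⟩ := e.surjective (Pi.single i M)
    have hM : M = (Pi.evalAlgHom ℂ (fun i => Matrix (Fin (d i)) (Fin (d i)) ℂ) i).comp
      e.toAlgHom x := by simp [hx]
    rw [hM]
    clear hM hx
    induction x using MonoidAlgebra.induction_on with
    | of g => exact Submodule.subset_span ⟨g, rfl⟩
    | add x y hx hy => rw [map_add]; exact add_mem hx hy
    | smul a x hx => rw [map_smul]; exact Submodule.smul_mem _ _ hx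
  choose τ hτ hτ2 using fun i =>
    have := hd i
    exists_isSchurRep_of_span (σ i) (hσ i)
  have htr : ∀ g, ∑ i, (d i : ℂ) * (τ i g).trace = if g = 1 then (Fintype.card G : ℂ) else 0 := by
    intro g
    rw [← trace_mulLeft_monoidAlgebra, ← LinearMap.trace_conj' _ e.toLinearEquiv]
    rw [show (LinearEquiv.conj e.toLinearEquiv) (LinearMap.mulLeft ℂ (MonoidAlgebra.of ℂ G g)) =
      LinearMap.mulLeft ℂ (e (MonoidAlgebra.of ℂ G g)) by
        refine LinearMap.ext fun x => ?_; simp [LinearEquiv.conj_apply]]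
    rw [trace_mulLeft_pi_matrix]
    simp [hτ2, σ]
  -- Each Wedderburn block is listed as many times as its dimension, its multiplicity in the regular
  -- representation.
  let φ := (Fintype.equivFin (Σ i, Fin (d i))).symm
  refine ⟨_, fun j => d (φ j).1, fun j => τ (φ j).1,
    fun j => Nat.pos_of_ne_zero (hd _).out, fun j => hτ _, fun g => ?_⟩
  have h2 : ∀ i, ∑ _y : Fin (d i), (τ i g).trace = d i * (τ i g).trace := by simp
  rw [← htr, sum_congr rfl fun i _ => (h2 i).symm, ← Fintype.sum_sigma
    (fun p : Σ i, Fin (d i) => (τ p.1 g).trace)]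
  exact Fintype.sum_equiv φ _ _ fun _ => rfl

/-! ### Lower bound for the dimension of nontrivial representations of `SL(2, F)`. -/

section SpecialLinear

open Matrix.SpecialLinearGroup

variable {F : Type*} [Field F]

/-- The upper unipotent elements generate `SL(2, F)` up to conjugation. -/
theorem monoidHom_eq_one_of_transvection {M : Type*} [Monoid M] (ρ : SL(2, F) →* M)
    (h : ∀ b : F, ρ (transvection zero_ne_one b) = 1) : ρ = 1 := by
  refine MonoidHom.ext fun g => ?_
  refine Matrix.SL2.transvection_induction (fun g => ρ g = 1) (fun i j hij c => ?_)
    (fun A B hA hB => by rw [map_mul, hA, hB, one_mul]) g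
  fin_cases i
  · obtain rfl : j = 1 := by fin_cases j <;> tauto
    exact h c
  · obtain rfl : j = 0 := by fin_cases j <;> tauto
    change ρ (transvection one_ne_zero c) = 1
    -- The Weyl element conjugates lower unipotents to upper ones.
    let w : SL(2, F) := ⟨!![0, 1; -1, 0], by simp [Matrix.det_fin_two]⟩
    have hw : transvection one_ne_zero c * w = w * transvection zero_ne_one (-c) := by
      refine Subtype.ext ?_
      rw [Matrix.SpecialLinearGroup.coe_mul, Matrix.SpecialLinearGroup.coe_mul, transvection_coe, transvection_coe]
      ext i j
      fin_cases i <;> fin_cases j <;>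
        simp [w, Matrix.mul_apply, Fin.sum_univ_two, Matrix.single_apply]
    have h1 : ρ (transvection one_ne_zero c) * ρ w = ρ w := by
      rw [← map_mul, hw, map_mul, h, mul_one]
    have h2 : ρ w * ρ w⁻¹ = 1 := by rw [← map_mul, mul_inv_cancel, map_one]
    rw [← mul_one (ρ (transvection one_ne_zero c)), ← h2, ← mul_assoc, h1]

/-- The torus rescales the unipotent subgroup by squares, so it moves one eigencharacter of that
subgroup to a whole orbit indexed by the nonzero squares. -/
theorem transvection_mul_diag2 {t : F} (ht : t ≠ 0) (b : F) :
    transvection zero_ne_one b * Matrix.SpecialLinearGroup.diag2 t ht =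
      Matrix.SpecialLinearGroup.diag2 t ht * transvection zero_ne_one ((t ^ 2)⁻¹ * b) := by
  ext i j
  fin_cases i <;> fin_cases j <;>
    simp [transvection_coe, diag2_coe', Matrix.mul_apply, Fin.sum_univ_two, Matrix.single_apply]
  field_simp

theorem card_le_two_mul_card_range_sq [Fintype F] [DecidableEq F] :
    Fintype.card F - 1 ≤ 2 * (univ.image fun t : Fˣ => t ^ 2).card := by
  rw [← Fintype.card_units, ← card_univ]
  refine card_le_mul_card_image (f := fun t : Fˣ => t ^ 2) univ 2 fun a ha => ?_
  obtain ⟨t, -, rfl⟩ := mem_image.1 ha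
  refine (card_le_card (t := ({t, -t} : Finset Fˣ)) fun x hx => ?_).trans card_le_two
  have h : (x : F) ^ 2 = (t : F) ^ 2 := by
    exact_mod_cast congrArg Units.val (mem_filter.1 hx).2
  rw [mem_insert, mem_singleton]
  exact (sq_eq_sq_iff_eq_or_eq_neg.1 h).imp Units.ext fun h => Units.ext h

/-- A nontrivial unitary representation of `SL(2, F)` restricted to the unipotent subgroup contains
a nontrivial character. -/
theorem exists_addChar_eigenvector [Fintype F] {n : Type*} [Fintype n] [DecidableEq n]
    (ρ : SL(2, F) →* Matrix n n ℂ) (hρ : ρ ≠ 1) :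
    ∃ ψ : AddChar F ℂ, ψ ≠ 0 ∧ ∃ v : n → ℂ, v ≠ 0 ∧
      ∀ b, ρ (transvection zero_ne_one b) *ᵥ v = ψ b • v := by
  classical
  set u : F → Matrix n n ℂ := fun b => ρ (transvection zero_ne_one b) with hu
  have hu_add : ∀ a b, u (a + b) = u a * u b := fun a b => by
    simp only [hu, transvection_add, map_mul]
  have hu0 : u 0 = 1 := by simp [hu]
  -- Unnormalized projections onto the eigenspaces of the unipotent subgroup. If only the trivial
  -- character contributed, all unipotents would act trivially.
  let P : AddChar F ℂ → Matrix n n ℂ := fun ψ => ∑ b, ψ (-b) • u b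
  have hP : ∀ ψ c, u c * P ψ = ψ c • P ψ := by
    intro ψ c
    simp only [P, Finset.mul_sum, Finset.smul_sum]
    refine Fintype.sum_equiv (Equiv.addLeft c) _ _ fun b => ?_
    rw [mul_smul_comm, ← hu_add, smul_smul, ← AddChar.map_add_eq_mul]
    simp
  have hsum : ∑ ψ, P ψ = (Fintype.card F : ℂ) • (1 : Matrix n n ℂ) := by
    simp only [P]
    rw [Finset.sum_comm]
    simp_rw [← Finset.sum_smul, AddChar.sum_apply_eq_ite, neg_eq_zero]
    simp [hu0]
  obtain ⟨ψ, hψ, hPψ⟩ : ∃ ψ : AddChar F ℂ, ψ ≠ 0 ∧ P ψ ≠ 0 := by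
    by_contra! hcon
    refine hρ (monoidHom_eq_one_of_transvection ρ fun c => ?_)
    rw [Finset.sum_eq_single 0 (fun ψ _ h => hcon ψ h) (by simp)] at hsum
    have h1 := hP 0 c
    rw [hsum, mul_smul_comm, mul_one] at h1
    have h2 : (Fintype.card F : ℂ) ≠ 0 := Nat.cast_ne_zero.2 Fintype.card_ne_zero
    refine smul_right_injective _ h2 (h1.trans ?_)
    simp
  obtain ⟨j, hj⟩ : ∃ j, (P ψ).col j ≠ 0 := by
    by_contra! hcon
    exact hPψ (by ext i j; exact congrFun (hcon j) i)
  refine ⟨ψ, hψ, (P ψ).col j, hj, fun b => ?_⟩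
  ext i
  exact congrFun (congrFun (hP ψ b) i) j

/-- Nontrivial unitary representations of `SL(2, F)` have dimension at least the number of nonzero
squares of `F`. -/
theorem card_range_sq_le [Fintype F] [DecidableEq F] {n : Type*} [Fintype n] [DecidableEq n]
    (ρ : SL(2, F) →* Matrix n n ℂ) (hU : ∀ g, (ρ g)ᴴ = ρ g⁻¹) (hρ : ρ ≠ 1) :
    (univ.image fun t : Fˣ => t ^ 2).card ≤ Fintype.card n := by
  obtain ⟨ψ, hψ, v, hv, hev⟩ := exists_addChar_eigenvector ρ hρ
  set Q := univ.image fun t : Fˣ => t ^ 2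
  have hmul : ∀ g, ρ g⁻¹ * ρ g = 1 := fun g => by rw [← map_mul, inv_mul_cancel, map_one]
  have hex : ∀ s : Q, ∃ w : n → ℂ, w ≠ 0 ∧
      ∀ b, ρ (transvection zero_ne_one b) *ᵥ w = ψ (((s : Fˣ) : F)⁻¹ * b) • w := by
    rintro ⟨s, hs⟩
    obtain ⟨t, -, rfl⟩ := mem_image.1 hs
    refine ⟨ρ (diag2 (t : F) t.ne_zero) *ᵥ v, fun h0 => hv ?_, fun b => ?_⟩
    · have := congrArg (fun x => ρ (diag2 (t : F) t.ne_zero)⁻¹ *ᵥ x) h0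
      simpa [Matrix.mulVec_mulVec, hmul] using this
    · rw [Matrix.mulVec_mulVec, ← map_mul, transvection_mul_diag2, map_mul, ← Matrix.mulVec_mulVec,
        hev, Matrix.mulVec_smul, Units.val_pow_eq_pow_val]
  choose w hw hwev using hex
  have hlin : LinearIndependent ℂ fun s : Q => (WithLp.toLp 2 (w s) : EuclideanSpace ℂ n) := by
    refine linearIndependent_of_ne_zero_of_inner_eq_zero (fun s h => hw s ?_) fun s s' hss => ?_
    · simpa using h
    · obtain ⟨b, hb⟩ : ∃ b, ψ b ≠ 1 := (AddChar.ne_zero_iff).1 hψ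
      set x : F := ((s : Fˣ) : F)⁻¹
      set y : F := ((s' : Fˣ) : F)⁻¹
      have hxy : x - y ≠ 0 := by
        rw [sub_ne_zero]
        intro h
        exact hss (Subtype.ext (Units.ext (inv_injective h)))
      rw [EuclideanSpace.inner_toLp_toLp]
      -- At this argument the two eigencharacters differ by the factor `ψ b ≠ 1`, so unitarity
      -- forces orthogonality.
      set c := (x - y)⁻¹ * b
      have h1 : star (ρ (transvection zero_ne_one c) *ᵥ w s) ⬝ᵥ
          (ρ (transvection zero_ne_one c) *ᵥ w s') = star (w s) ⬝ᵥ w s' := by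
        rw [Matrix.star_mulVec, Matrix.dotProduct_mulVec, Matrix.vecMul_vecMul, hU, hmul,
          Matrix.vecMul_one]
      rw [hwev, hwev, star_smul, smul_dotProduct, dotProduct_smul, smul_smul, smul_eq_mul] at h1
      have h2 : star (ψ (x * c)) * ψ (y * c) = (ψ b)⁻¹ := by
        rw [← AddChar.map_neg_eq_inv]
        have : -b = -(x * c) + y * c := by
          simp only [c]; field_simp; ring
        rw [this, AddChar.map_add_eq_mul, AddChar.map_neg_eq_conj]
        rfl
      rw [h2] at h1
      rw [dotProduct_comm]
      by_contra hne
      exact hb (inv_eq_one.1 (mul_right_cancel₀ hne (h1.trans (one_mul _).symm)))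
  simpa using hlin.fintype_card_le_finrank

theorem card_le_pow_of_ne_one [Fintype F] [DecidableEq F] {n : Type*} [Fintype n] [DecidableEq n]
    (hF : 4 ≤ Fintype.card F)
    (ρ : SL(2, F) →* Matrix n n ℂ) (hU : ∀ g, (ρ g)ᴴ = ρ g⁻¹) (hρ : ρ ≠ 1) :
    2 ≤ Fintype.card n ∧ Fintype.card SL(2, F) ≤ Fintype.card n ^ 12 := by
  have h1 := card_range_sq_le ρ hU hρ
  have h2 := card_le_two_mul_card_range_sq (F := F)
  -- The hypothesis `4 ≤ q` acts here: `q - 1 ≤ 2 * n` excludes dimension 1. The exponent 12 is 3 *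
  -- 4, from `q ≤ 2 * n + 1 ≤ n ^ 3` and the crude bound `q ^ 4` for the group order.
  have h3 : 2 ≤ Fintype.card n := by omega
  refine ⟨h3, ?_⟩
  have h4 : Fintype.card F ≤ Fintype.card n ^ 3 := by
    have : Fintype.card F ≤ 2 * Fintype.card n + 1 := by omega
    nlinarith [Nat.mul_le_mul h3 h3, Nat.mul_le_mul (Nat.mul_le_mul h3 h3) h3,
      Nat.mul_le_mul_left (Fintype.card n) (Nat.mul_le_mul h3 h3)]
  calc Fintype.card SL(2, F) ≤ Fintype.card (Matrix (Fin 2) (Fin 2) F) :=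
        Fintype.card_le_of_injective _ Subtype.val_injective
    _ = Fintype.card F ^ 4 := by
        change Fintype.card (Fin 2 → Fin 2 → F) = _
        simp only [Fintype.card_fun, Fintype.card_fin, ← pow_mul]
    _ ≤ (Fintype.card n ^ 3) ^ 4 := Nat.pow_le_pow_left h4 4
    _ = _ := by rw [← pow_mul]

end SpecialLinear

/-! ### Frobenius norm estimates and Bessel's inequality. -/

/-- The square of the Frobenius norm of a matrix. -/
noncomputable def Matrix.frobSq {m n : Type*} [Fintype m] [Fintype n] (A : Matrix m n ℂ) : ℝ :=
  ∑ i, ∑ j, ‖A i j‖ ^ 2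

namespace Matrix

section FrobSq

variable {m n : Type*} [Fintype m] [Fintype n]

theorem frobSq_nonneg (A : Matrix m n ℂ) : 0 ≤ A.frobSq := by
  unfold frobSq; positivity

theorem frobSq_conjTranspose (A : Matrix m n ℂ) : Aᴴ.frobSq = A.frobSq := by
  simp only [frobSq, conjTranspose_apply, norm_star]
  exact Finset.sum_comm

theorem ofReal_frobSq (A : Matrix m n ℂ) : (A.frobSq : ℂ) = (A * Aᴴ).trace := by
  simp only [frobSq, trace, diag, mul_apply, conjTranspose_apply]
  push_cast
  refine Finset.sum_congr rfl fun i _ => Finset.sum_congr rfl fun j _ => ?_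
  exact (Complex.mul_conj' _).symm

theorem norm_sum_sq_le {ι : Type*} [Fintype ι] (z : ι → ℂ) :
    ‖∑ i, z i‖ ^ 2 ≤ Fintype.card ι * ∑ i, ‖z i‖ ^ 2 :=
  (pow_le_pow_left₀ (norm_nonneg _) (norm_sum_le _ _) 2).trans
    (by simpa using sq_sum_le_card_mul_sum_sq (s := Finset.univ) (f := fun i => ‖z i‖))

theorem frobSq_sum_le {ι : Type*} [Fintype ι] (M : ι → Matrix m n ℂ) :
    (∑ y, M y).frobSq ≤ Fintype.card ι * ∑ y, (M y).frobSq := by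
  simp only [frobSq, sum_apply]
  calc ∑ i, ∑ j, ‖∑ y, M y i j‖ ^ 2
      ≤ ∑ i, ∑ j, Fintype.card ι * ∑ y, ‖M y i j‖ ^ 2 :=
        Finset.sum_le_sum fun i _ => Finset.sum_le_sum fun j _ => norm_sum_sq_le _
    _ = _ := by
        simp only [← Finset.mul_sum]
        congr 1
        exact (Finset.sum_congr rfl fun i _ => Finset.sum_comm).trans Finset.sum_comm

theorem norm_sum_mul_sq_le {ι : Type*} (s : Finset ι) (a b : ι → ℂ) :
    ‖∑ i ∈ s, a i * b i‖ ^ 2 ≤ (∑ i ∈ s, ‖a i‖ ^ 2) * ∑ i ∈ s, ‖b i‖ ^ 2 := by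
  refine (pow_le_pow_left₀ (norm_nonneg _) (norm_sum_le _ _) 2).trans ?_
  simp only [norm_mul]
  exact Finset.sum_mul_sq_le_sq_mul_sq _ _ _

theorem norm_trace_mul_sq_le (A : Matrix m n ℂ) (B : Matrix n m ℂ) :
    ‖(A * B).trace‖ ^ 2 ≤ A.frobSq * B.frobSq := by
  have h := norm_sum_mul_sq_le Finset.univ (fun p : m × n => A p.1 p.2) fun p => B p.2 p.1
  simp only [Fintype.sum_prod_type] at h
  rw [← frobSq_conjTranspose B]
  simpa [trace, mul_apply, frobSq] using h

theorem l2_opNorm_sq_le_frobSq [DecidableEq n] (A : Matrix m n ℂ) : ‖A‖ ^ 2 ≤ A.frobSq := by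
  have h : ‖A‖ ≤ √A.frobSq := by
    rw [l2_opNorm_def]
    refine ContinuousLinearMap.opNorm_le_bound _ (Real.sqrt_nonneg _) fun x => ?_
    rw [EuclideanSpace.norm_eq, EuclideanSpace.norm_eq, ← Real.sqrt_mul (frobSq_nonneg A)]
    refine Real.sqrt_le_sqrt ?_
    rw [frobSq, Finset.sum_mul]
    exact Finset.sum_le_sum fun i _ => norm_sum_mul_sq_le _ _ _
  calc ‖A‖ ^ 2 ≤ √A.frobSq ^ 2 := pow_le_pow_left₀ (norm_nonneg _) h 2
    _ = _ := Real.sq_sqrt (frobSq_nonneg A)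

theorem norm_trace_le_card_mul_norm [DecidableEq n] (A : Matrix n n ℂ) :
    ‖A.trace‖ ≤ Fintype.card n * ‖A‖ := by
  have h : ∀ i, ‖A i i‖ ≤ ‖A‖ := fun i => by
    have h1 := A.l2_opNorm_mulVec (EuclideanSpace.single i 1)
    refine le_trans ?_ (h1.trans_eq (by simp))
    refine le_trans (le_of_eq ?_) (PiLp.norm_apply_le _ i)
    simp
  calc ‖A.trace‖ ≤ ∑ i, ‖A i i‖ := norm_sum_le _ _
    _ ≤ ∑ _i : n, ‖A‖ := Finset.sum_le_sum fun i _ => h i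
    _ = _ := by simp

end FrobSq

end Matrix

namespace IsSchurRep

variable {G n : Type*} [Group G] [Fintype G] [Fintype n] [DecidableEq n] {ρ : G →* Matrix n n ℂ}

theorem sum_norm_trace_sq_le (h : IsSchurRep ρ) :
    ∑ g, ‖(ρ g).trace‖ ^ 2 ≤ Fintype.card G := by
  have h1 : ((∑ g, ‖(ρ g).trace‖ ^ 2 : ℝ) : ℂ) =
      ((Fintype.card n * ((Fintype.card G : ℝ) / Fintype.card n) : ℝ) : ℂ) := by
    push_cast
    calc ∑ g, (‖(ρ g).trace‖ : ℂ) ^ 2 = ∑ g, ∑ i, ∑ k, ρ g i i * star (ρ g k k) := by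
          refine sum_congr rfl fun g _ => ?_
          rw [← Complex.mul_conj', Matrix.trace, map_sum, sum_mul_sum]
          rfl
      _ = ∑ i, ∑ k, ∑ g, ρ g i i * star (ρ g k k) := by
          rw [sum_comm]
          exact sum_congr rfl fun i _ => sum_comm
      _ = _ := by simp only [h.sum_mul_star]; simp
  rw [Complex.ofReal_inj.1 h1]
  rcases Nat.eq_zero_or_pos (Fintype.card n) with h0 | h0
  · simp [h0]
  · rw [mul_div_cancel₀]
    positivity

/-- Bessel's inequality for the matrix coefficients of a Schur representation. -/
theorem frobSq_sum_smul_le (h : IsSchurRep ρ) (F : G → ℂ) :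
    (∑ a, F a • ρ a).frobSq ≤ (Fintype.card G : ℝ) / Fintype.card n * ∑ a, ‖F a‖ ^ 2 := by
  set Y := ∑ a, F a • ρ a with hY
  -- Duality: orthogonality computes the ℓ² norm of the pairings `Z` of `ρ a` with `Y`, while the
  -- squared norm of `Y` is `∑ F a * Z a`. Cauchy–Schwarz then lets one power of `Y.frobSq` cancel.
  let Z : G → ℂ := fun a => ∑ i, ∑ j, ρ a i j * star (Y i j)
  have hZ : ∑ a, ‖Z a‖ ^ 2 = (Fintype.card G : ℝ) / Fintype.card n * Y.frobSq := by
    apply Complex.ofReal_injective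
    rw [Matrix.frobSq]
    push_cast
    calc ∑ a, (‖Z a‖ : ℂ) ^ 2
        = ∑ a, ∑ p : n × n, ∑ q : n × n, star (Y p.1 p.2) * Y q.1 q.2 *
            (ρ a p.1 p.2 * star (ρ a q.1 q.2)) := by
          refine sum_congr rfl fun a _ => ?_
          rw [← Complex.mul_conj']
          simp only [Z, ← Fintype.sum_prod_type', map_sum, sum_mul_sum]
          refine sum_congr rfl fun p _ => ?_
          simp
          ring
      _ = ∑ p : n × n, ∑ q : n × n, star (Y p.1 p.2) * Y q.1 q.2 *
            ∑ a, ρ a p.1 p.2 * star (ρ a q.1 q.2) := by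
          rw [sum_comm]
          refine sum_congr rfl fun p _ => ?_
          rw [sum_comm]
          simp only [mul_sum]
      _ = _ := by
          simp only [h.sum_mul_star, ← Prod.ext_iff, mul_ite, mul_zero, sum_ite_eq, mem_univ,
            if_true]
          rw [Fintype.sum_prod_type, mul_sum]
          refine sum_congr rfl fun i _ => ?_
          rw [mul_sum]
          refine sum_congr rfl fun j _ => ?_
          rw [← Complex.conj_mul', mul_comm]
          rfl
  have hS : (Y.frobSq : ℂ) = ∑ a, F a * Z a := by
    rw [Matrix.frobSq]
    push_cast
    simp only [Z, mul_sum]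
    conv_rhs => rw [sum_comm]
    refine sum_congr rfl fun i _ => ?_
    conv_rhs => rw [sum_comm]
    refine sum_congr rfl fun j _ => ?_
    simp only [← mul_assoc, ← sum_mul]
    rw [← Complex.mul_conj']
    congr 1
    simp [hY, Matrix.sum_apply]
  have hcs : Y.frobSq ^ 2 ≤ (∑ a, ‖F a‖ ^ 2) * ∑ a, ‖Z a‖ ^ 2 := by
    have := Matrix.norm_sum_mul_sq_le univ F Z
    rwa [← hS, Complex.norm_real, Real.norm_eq_abs, sq_abs] at this
  rw [hZ] at hcs
  rcases (Matrix.frobSq_nonneg Y).eq_or_lt with h0 | h0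
  · rw [← h0]; positivity
  · refine le_of_mul_le_mul_right ?_ h0
    linarith [hcs]

end IsSchurRep

/-! ### The tripartite operator norm estimate. -/

/-- A weighted sum of values of a Schur representation, twisted by a function of another variable,
is small if the marginals of the weight are bounded by uniform ones. -/
theorem IsSchurRep.frobSq_weighted_sum_le {Ω G H n : Type*} [Fintype Ω] [Group G] [Fintype G]
    [DecidableEq G] [Fintype H] [Nonempty H] [DecidableEq H] [Fintype n] [DecidableEq n]
    {σ : G →* Matrix n n ℂ}
    (hσ : IsSchurRep σ) (w : Ω → ℝ) (hw : ∀ ω, 0 ≤ w ω) (a : Ω → G) (c : Ω → H) (φ : H → ℂ)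
    (hφ : ∑ x, ‖φ x‖ ^ 2 ≤ Fintype.card H) {A : ℝ} (hA : 0 ≤ A)
    (ha : ∀ x, ∑ ω with a ω = x, w ω ≤ A / Fintype.card G)
    (hc : ∀ x, ∑ ω with c ω = x, w ω ≤ A / Fintype.card H) :
    (∑ ω, (w ω * φ (c ω)) • σ (a ω)).frobSq ≤ A ^ 2 / Fintype.card n := by
  let F : G → ℂ := fun x => ∑ ω with a ω = x, w ω * φ (c ω)
  have hF : ∑ ω, (w ω * φ (c ω)) • σ (a ω) = ∑ x, F x • σ x := by
    rw [← sum_fiberwise univ a]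
    refine sum_congr rfl fun x _ => ?_
    rw [sum_smul]
    exact sum_congr rfl fun ω hω => by rw [(mem_filter.1 hω).2]
  -- Cauchy–Schwarz with the weight split as `√w * √w`: one factor is controlled by the law of `a`,
  -- the other, after summing over `x`, by the law of `c`.
  have hFx : ∀ x, ‖F x‖ ^ 2 ≤ A / Fintype.card G * ∑ ω with a ω = x, w ω * ‖φ (c ω)‖ ^ 2 := by
    intro x
    have h1 := Matrix.norm_sum_mul_sq_le (univ.filter fun ω => a ω = x)
      (fun ω => (√(w ω) : ℂ)) fun ω => √(w ω) * φ (c ω)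
    have h2 : ∀ ω, (√(w ω) : ℂ) * (√(w ω) * φ (c ω)) = w ω * φ (c ω) := fun ω => by
      rw [← mul_assoc, ← Complex.ofReal_mul, Real.mul_self_sqrt (hw ω)]
    have h3 : ∀ ω, ‖(√(w ω) : ℂ)‖ ^ 2 = w ω := fun ω => by
      rw [Complex.norm_real, Real.norm_eq_abs, sq_abs, Real.sq_sqrt (hw ω)]
    simp only [h2, norm_mul, mul_pow, h3] at h1
    exact h1.trans (mul_le_mul_of_nonneg_right (ha x)
      (sum_nonneg fun ω _ => mul_nonneg (hw ω) (sq_nonneg _)))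
  have htot : ∑ ω, w ω * ‖φ (c ω)‖ ^ 2 ≤ A := by
    rw [← sum_fiberwise univ c]
    calc ∑ x, ∑ ω with c ω = x, w ω * ‖φ (c ω)‖ ^ 2
        = ∑ x, (∑ ω with c ω = x, w ω) * ‖φ x‖ ^ 2 := by
          refine sum_congr rfl fun x _ => ?_
          rw [sum_mul]
          exact sum_congr rfl fun ω hω => by rw [(mem_filter.1 hω).2]
      _ ≤ ∑ x, A / Fintype.card H * ‖φ x‖ ^ 2 :=
          sum_le_sum fun x _ => mul_le_mul_of_nonneg_right (hc x) (sq_nonneg _)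
      _ = A / Fintype.card H * ∑ x, ‖φ x‖ ^ 2 := by rw [mul_sum]
      _ ≤ A / Fintype.card H * Fintype.card H := by gcongr
      _ = A := by field_simp
  rw [hF]
  have hG : (0 : ℝ) < Fintype.card G := by exact_mod_cast Fintype.card_pos
  calc _ ≤ (Fintype.card G : ℝ) / Fintype.card n * ∑ x, ‖F x‖ ^ 2 := hσ.frobSq_sum_smul_le F
    _ ≤ (Fintype.card G : ℝ) / Fintype.card n *
        ∑ x, A / Fintype.card G * ∑ ω with a ω = x, w ω * ‖φ (c ω)‖ ^ 2 := by
        gcongr with x _; exact hFx x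
    _ = (A / Fintype.card n) * ∑ ω, w ω * ‖φ (c ω)‖ ^ 2 := by
        rw [← mul_sum, sum_fiberwise]; field_simp
    _ ≤ (A / Fintype.card n) * A := by gcongr
    _ = _ := by ring

/-- Given the first point `g`, the second must have `Y`-value `Y g` and `X`-value `X g * a`, which
has weight bounded by the joint marginal; the remaining sum over `g` is at most `K`. -/
theorem sum_pairs_le {Γ G H : Type*} [Fintype Γ] [Group G] [Fintype G] [DecidableEq G] [Fintype H]
    [DecidableEq H] [Nonempty H] (f : Γ → ℝ) (hf : ∀ g, 0 ≤ f g) (X : Γ → G) (Y : Γ → H)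
    {K : ℝ} (hK : 0 ≤ K)
    (h : ∀ x y, ∑ g with X g = x ∧ Y g = y, f g ≤ K / (Fintype.card G * Fintype.card H)) (a : G) :
    ∑ p : Γ × Γ with (X p.1)⁻¹ * X p.2 = a, (if Y p.1 = Y p.2 then f p.1 * f p.2 else 0) ≤
      K ^ 2 / Fintype.card H / Fintype.card G := by
  have htot : ∑ g, f g ≤ K := by
    rw [← sum_fiberwise univ fun g => (X g, Y g)]
    calc _ ≤ ∑ _p : G × H, K / (Fintype.card G * Fintype.card H) :=
          sum_le_sum fun p _ => by simpa [Prod.ext_iff] using h p.1 p.2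
      _ = K := by
          have : (Fintype.card G : ℝ) ≠ 0 := Nat.cast_ne_zero.2 Fintype.card_ne_zero
          simp; field_simp
  rw [sum_filter, Fintype.sum_prod_type]
  calc _ = ∑ g, f g * ∑ g' with X g' = X g * a ∧ Y g' = Y g, f g' := by
        refine sum_congr rfl fun g _ => ?_
        rw [mul_sum, sum_filter]
        refine sum_congr rfl fun g' _ => ?_
        simp only [inv_mul_eq_iff_eq_mul, eq_comm (a := Y g')]
        split_ifs <;> simp_all
    _ ≤ ∑ g, f g * (K / (Fintype.card G * Fintype.card H)) :=
        sum_le_sum fun g _ => mul_le_mul_of_nonneg_left (h _ _) (hf g)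
    _ = (∑ g, f g) * (K / (Fintype.card G * Fintype.card H)) := by rw [sum_mul]
    _ ≤ K * (K / (Fintype.card G * Fintype.card H)) := by gcongr
    _ = _ := by
        have : (Fintype.card G : ℝ) ≠ 0 := Nat.cast_ne_zero.2 Fintype.card_ne_zero
        field_simp

/-- Expanding the squares of the fibre sums leaves pairs lying in a common fibre; for such pairs the
quotient `p.1⁻¹ * p.2` is trivial under `Y` when `Y` is a homomorphism. -/
theorem sum_conjTranspose_mul_fiberwise {Γ H N : Type*} [Group Γ] [Fintype Γ] [Fintype H]
    [DecidableEq H] [Fintype N] [DecidableEq N] (R : Γ →* Matrix N N ℂ)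
    (hR : ∀ g, (R g)ᴴ = R g⁻¹) (f : Γ → ℝ) (Y : Γ → H) :
    ∑ y, (∑ g with Y g = y, (f g : ℂ) • R g)ᴴ * (∑ g with Y g = y, (f g : ℂ) • R g) =
      ∑ p : Γ × Γ, ((if Y p.1 = Y p.2 then f p.1 * f p.2 else 0 : ℝ) : ℂ) • R (p.1⁻¹ * p.2) := by
  simp only [Matrix.conjTranspose_sum, Matrix.conjTranspose_smul, hR, sum_mul_sum, smul_mul_smul_comm,
    ← map_mul]
  rw [Fintype.sum_prod_type, ← sum_fiberwise univ Y]
  refine sum_congr rfl fun y _ => sum_congr rfl fun g hg => ?_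
  rw [sum_filter]
  refine sum_congr rfl fun g' _ => ?_
  rw [(mem_filter.1 hg).2]
  simp only [eq_comm (a := y)]
  split_ifs <;> simp

/-- A tripartite operator average is small in norm as soon as the pair marginals of the weight are
bounded by uniform ones. -/
theorem norm_sum_smul_pow_four_le {Γ G₁ G₂ G₃ n N : Type*} [Group Γ] [Fintype Γ]
    [Group G₁] [Fintype G₁] [DecidableEq G₁] [Group G₂] [Fintype G₂] [DecidableEq G₂]
    [Group G₃] [Fintype G₃] [DecidableEq G₃]
    [Fintype n] [DecidableEq n] [Fintype N] [DecidableEq N]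
    (R : Γ →* Matrix N N ℂ) (hR : ∀ g, (R g)ᴴ = R g⁻¹)
    (X : Γ →* G₁) (Y : Γ →* G₂) (Z : Γ →* G₃)
    {σ : G₁ →* Matrix n n ℂ} (hσ : IsSchurRep σ) (φ : G₂ → ℂ) (θ : G₃ → ℂ)
    (hφ : ∑ x, ‖φ x‖ ^ 2 ≤ Fintype.card G₂) (hθ : ∑ x, ‖θ x‖ ^ 2 ≤ Fintype.card G₃)
    (htr : ∀ g, (R g).trace = (σ (X g)).trace * φ (Y g) * θ (Z g))
    (f : Γ → ℝ) (hf : ∀ g, 0 ≤ f g) {K : ℝ} (hK : 0 ≤ K)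
    (hXY : ∀ x y, ∑ g with X g = x ∧ Y g = y, f g ≤ K / (Fintype.card G₁ * Fintype.card G₂))
    (hXZ : ∀ x y, ∑ g with X g = x ∧ Z g = y, f g ≤ K / (Fintype.card G₁ * Fintype.card G₃))
    (hYZ : ∀ x y, ∑ g with Y g = x ∧ Z g = y, f g ≤ K / (Fintype.card G₂ * Fintype.card G₃)) :
    ‖∑ g, (f g : ℂ) • R g‖ ^ 4 ≤ K ^ 4 / Fintype.card n := by
  set T := ∑ g, (f g : ℂ) • R g with hT
  let V : G₂ → Matrix N N ℂ := fun y => ∑ g with Y g = y, (f g : ℂ) • R g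
  let U : G₃ → Matrix N N ℂ := fun z => ∑ g with Z g = z, (f g : ℂ) • R g
  have hV : T = ∑ y, V y := (sum_fiberwise univ Y _).symm
  have hU : T = ∑ z, U z := (sum_fiberwise univ Z _).symm
  have hZY : ∀ x y, ∑ g with Z g = x ∧ Y g = y, f g ≤
      K / (Fintype.card G₃ * Fintype.card G₂) := fun x y => by
    rw [mul_comm (Fintype.card G₃ : ℝ)]; simpa only [and_comm] using hYZ y x
  let w₂ : Γ × Γ → ℝ := fun p => if Y p.1 = Y p.2 then f p.1 * f p.2 else 0
  let w₃ : Γ × Γ → ℝ := fun p => if Z p.1 = Z p.2 then f p.1 * f p.2 else 0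
  have hw₂ : ∀ p, 0 ≤ w₂ p := fun p => by
    simp only [w₂]; split_ifs; exacts [mul_nonneg (hf _) (hf _), le_rfl]
  have hw₃ : ∀ p, 0 ≤ w₃ p := fun p => by
    simp only [w₃]; split_ifs; exacts [mul_nonneg (hf _) (hf _), le_rfl]
  let A₂ := ∑ p, ((w₂ p : ℂ) * θ ((Z p.1)⁻¹ * Z p.2)) • σ ((X p.1)⁻¹ * X p.2)
  let A₃ := ∑ p, ((w₃ p : ℂ) * φ ((Y p.1)⁻¹ * Y p.2)) • σ ((X p.1)⁻¹ * X p.2)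
  have hA₂ : A₂.frobSq ≤ (K ^ 2 / Fintype.card G₂) ^ 2 / Fintype.card n :=
    hσ.frobSq_weighted_sum_le w₂ hw₂ _ _ θ hθ (by positivity)
      (sum_pairs_le f hf X Y hK hXY) (sum_pairs_le f hf Z Y hK hZY)
  have hA₃ : A₃.frobSq ≤ (K ^ 2 / Fintype.card G₃) ^ 2 / Fintype.card n :=
    hσ.frobSq_weighted_sum_le w₃ hw₃ _ _ φ hφ (by positivity)
      (sum_pairs_le f hf X Z hK hXZ) (sum_pairs_le f hf Y Z hK hYZ)
  -- The decoupling step. Pairs from the `Z`-fibres have trivial `Z`-quotient and pairs from the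
  -- `Y`-fibres trivial `Y`-quotient, so in the factored character `φ` sees only the first pair and
  -- `θ` only the second. What remains is the trace of a product of two `σ`-averages.
  have hsum : ((∑ y, ∑ z, (U z * (V y)ᴴ).frobSq : ℝ) : ℂ) = (A₃ * A₂).trace := by
    calc _ = ((∑ z, (U z)ᴴ * U z) * ∑ y, (V y)ᴴ * V y).trace := by
          push_cast
          rw [sum_mul_sum, Matrix.trace_sum, sum_comm]
          refine sum_congr rfl fun z _ => ?_
          rw [Matrix.trace_sum]
          refine sum_congr rfl fun y _ => ?_
          rw [Matrix.ofReal_frobSq, Matrix.conjTranspose_mul, Matrix.conjTranspose_conjTranspose,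
            ← mul_assoc, Matrix.trace_mul_comm]
          simp only [mul_assoc]
      _ = _ := by
          rw [sum_conjTranspose_mul_fiberwise R hR f Z, sum_conjTranspose_mul_fiberwise R hR f Y]
          simp only [A₃, A₂, sum_mul_sum, Matrix.trace_sum]
          refine sum_congr rfl fun p _ => sum_congr rfl fun q _ => ?_
          simp only [smul_mul_smul_comm, Matrix.trace_smul, ← map_mul, htr, w₂, w₃, smul_eq_mul]
          by_cases hp : Z p.1 = Z p.2
          · by_cases hq : Y q.1 = Y q.2
            · simp [hp, hq]
              ring
            · simp [hq]
          · simp [hp]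
  have hbound : ∑ y, ∑ z, (U z * (V y)ᴴ).frobSq ≤
      K ^ 4 / Fintype.card n / (Fintype.card G₂ * Fintype.card G₃) := by
    have h1 := Matrix.norm_trace_mul_sq_le A₃ A₂
    rw [← hsum, Complex.norm_real, Real.norm_eq_abs, sq_abs] at h1
    refine le_of_sq_le_sq ?_ (by positivity)
    refine h1.trans ((mul_le_mul hA₃ hA₂ (Matrix.frobSq_nonneg _) (by positivity)).trans_eq ?_)
    ring
  -- Cauchy–Schwarz over the `Y`-fibres of one factor and the `Z`-fibres of the other.
  have hTT : (T * Tᴴ).frobSq ≤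
      Fintype.card G₂ * ∑ y, Fintype.card G₃ * ∑ z, (U z * (V y)ᴴ).frobSq := by
    conv_lhs => rw [hV, sum_mul, ← hV]
    refine (Matrix.frobSq_sum_le _).trans ?_
    gcongr with y _
    rw [← Matrix.frobSq_conjTranspose, Matrix.conjTranspose_mul, Matrix.conjTranspose_conjTranspose,
      hU, sum_mul]
    exact Matrix.frobSq_sum_le _
  have hnorm : ‖T‖ ^ 4 = ‖T * Tᴴ‖ ^ 2 := by
    have := Matrix.l2_opNorm_conjTranspose_mul_self Tᴴ
    rw [Matrix.conjTranspose_conjTranspose, Matrix.l2_opNorm_conjTranspose] at this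
    rw [this]; ring
  rw [hnorm]
  refine (Matrix.l2_opNorm_sq_le_frobSq _).trans (hTT.trans ?_)
  rw [← mul_sum, ← mul_assoc]
  refine (mul_le_mul_of_nonneg_left hbound (by positivity)).trans_eq ?_
  have h2 : (Fintype.card G₂ : ℝ) ≠ 0 := Nat.cast_ne_zero.2 Fintype.card_ne_zero
  have h3 : (Fintype.card G₃ : ℝ) ≠ 0 := Nat.cast_ne_zero.2 Fintype.card_ne_zero
  field_simp

/-! ### Tensor product representations of powers of a group. -/

/-- The external tensor product of a family of matrix representations of `H`, as a representation
of a power of `H`. -/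
def piRep {H κ : Type*} [Group H] [Fintype κ] [DecidableEq κ] {n : κ → Type*}
    [∀ i, Fintype (n i)] [∀ i, DecidableEq (n i)] (ρ : ∀ i, H →* Matrix (n i) (n i) ℂ) :
    (κ → H) →* Matrix (∀ i, n i) (∀ i, n i) ℂ where
  toFun g := Matrix.of fun a b => ∏ i, ρ i (g i) (a i) (b i)
  map_one' := by
    ext a b
    simp only [Pi.one_apply, map_one, Matrix.of_apply, Matrix.one_apply]
    by_cases h : a = b
    · simp [h]
    · obtain ⟨i, hi⟩ := Function.ne_iff.1 h
      rw [if_neg h]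
      exact prod_eq_zero (mem_univ i) (by simp [hi])
  map_mul' x y := by
    ext a b
    simp only [Pi.mul_apply, map_mul, Matrix.of_apply, Matrix.mul_apply, Fintype.prod_sum,
      prod_mul_distrib]

section PiRep

variable {H κ : Type*} [Group H] [Fintype κ] [DecidableEq κ] {n : κ → Type*}
    [∀ i, Fintype (n i)] [∀ i, DecidableEq (n i)] (ρ : ∀ i, H →* Matrix (n i) (n i) ℂ)

theorem piRep_apply (g : κ → H) (a b : ∀ i, n i) :
    piRep ρ g a b = ∏ i, ρ i (g i) (a i) (b i) := rfl

theorem trace_piRep (g : κ → H) : (piRep ρ g).trace = ∏ i, (ρ i (g i)).trace := by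
  simp only [Matrix.trace, Fintype.prod_sum, Matrix.diag, piRep_apply]

theorem conjTranspose_piRep (hρ : ∀ i g, (ρ i g)ᴴ = ρ i g⁻¹) (g : κ → H) :
    (piRep ρ g)ᴴ = piRep ρ g⁻¹ := by
  ext a b
  simp only [Matrix.conjTranspose_apply, piRep_apply, star_prod, Pi.inv_apply, ← hρ]

theorem IsSchurRep.piRep [Fintype H] {ρ : ∀ i, H →* Matrix (n i) (n i) ℂ}
    (hρ : ∀ i, IsSchurRep (ρ i)) : IsSchurRep (piRep ρ) := by
  refine ⟨conjTranspose_piRep ρ fun i => (hρ i).conjTranspose_apply, fun a b c d => ?_⟩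
  simp only [piRep_apply, star_prod, ← prod_mul_distrib]
  rw [← Fintype.prod_sum (fun i h => ρ i h (a i) (b i) * star (ρ i h (c i) (d i)))]
  simp only [(hρ _).sum_mul_star]
  split_ifs with h
  · obtain ⟨rfl, rfl⟩ := h
    simp [prod_div_distrib]
  · rw [not_and_or] at h
    rcases h with h | h
    · obtain ⟨i, hi⟩ := Function.ne_iff.1 h
      exact prod_eq_zero (mem_univ i) (if_neg fun h => hi h.1)
    · obtain ⟨i, hi⟩ := Function.ne_iff.1 h
      exact prod_eq_zero (mem_univ i) (if_neg fun h => hi h.2)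

end PiRep

/-- Restriction of coordinates along a map of index types. -/
def restrictHom (H : Type*) [Group H] {ι κ : Type*} (e : κ → ι) : (ι → H) →* (κ → H) :=
  MonoidHom.pi fun i => Pi.evalMonoidHom _ (e i)

@[simp] theorem restrictHom_apply {H : Type*} [Group H] {ι κ : Type*} (e : κ → ι) (g : ι → H)
    (i : κ) : restrictHom H e g i = g (e i) := rfl

theorem norm_le_one_of_conjTranspose_eq {G N : Type*} [Group G] [Fintype N] [DecidableEq N]
    {R : G →* Matrix N N ℂ} (hR : ∀ g, (R g)ᴴ = R g⁻¹) (g : G) :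
    ‖R g‖ ≤ 1 := by
  have h := Matrix.l2_opNorm_conjTranspose_mul_self (R g)
  rw [hR, ← map_mul, inv_mul_cancel, map_one] at h
  have h1 : ‖(1 : Matrix N N ℂ)‖ ≤ 1 := by
    rcases isEmpty_or_nonempty N with hN | hN
    · rw [Subsingleton.elim (1 : Matrix N N ℂ) 0, norm_zero]; exact zero_le_one
    · exact CStarRing.norm_one.le
  nlinarith [norm_nonneg (R g)]

/-! ### Fourier coefficients of distributions and convolution. -/

namespace PMF

theorem toReal_bind_apply {α β : Type*} [Fintype α] (p : PMF α) (f : α → PMF β) (b : β) :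
    (p.bind f b).toReal = ∑ a, (p a).toReal * (f a b).toReal := by
  rw [bind_apply, tsum_fintype, ENNReal.toReal_sum]
  · simp [ENNReal.toReal_mul]
  · exact fun a _ => ENNReal.mul_ne_top (p.apply_ne_top a) ((f a).apply_ne_top b)

theorem toReal_map_apply {α β : Type*} [Fintype α] [DecidableEq β] (p : PMF α) (f : α → β)
    (b : β) : (p.map f b).toReal = ∑ a with f a = b, (p a).toReal := by
  rw [map_apply, tsum_fintype, ENNReal.toReal_sum, sum_filter]
  · refine sum_congr rfl fun a _ => ?_
    simp only [eq_comm (a := b)]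
    split_ifs <;> simp
  · intro a _
    split_ifs
    exacts [p.apply_ne_top a, ENNReal.zero_ne_top]

theorem sum_toReal {α : Type*} [Fintype α] (p : PMF α) : ∑ a, (p a).toReal = 1 := by
  rw [← ENNReal.toReal_sum fun a _ => p.apply_ne_top a, ← tsum_fintype (L := .unconditional _),
    p.tsum_coe, ENNReal.toReal_one]

section RepMean

variable {G N : Type*} [Group G] [Fintype G] [Fintype N] [DecidableEq N]

/-- The mean of a matrix representation under a distribution on the group. -/
def repMean (p : PMF G) (R : G →* Matrix N N ℂ) : Matrix N N ℂ :=
  ∑ g, ((p g).toReal : ℂ) • R g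

theorem sum_toReal_map_smul {β M : Type*} [Fintype β] [AddCommGroup M] [Module ℂ M]
    {α : Type*} [Fintype α]
    (p : PMF α) (f : α → β) (F : β → M) :
    ∑ b, ((p.map f b).toReal : ℂ) • F b = ∑ a, ((p a).toReal : ℂ) • F (f a) := by
  classical
  rw [← sum_fiberwise univ f]
  refine sum_congr rfl fun b _ => ?_
  rw [toReal_map_apply, Complex.ofReal_sum, sum_smul]
  exact sum_congr rfl fun a ha => by rw [(mem_filter.1 ha).2]

theorem repMean_groupConv (p q : PMF G) (R : G →* Matrix N N ℂ) :
    (p.groupConv q).repMean R = p.repMean R * q.repMean R := by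
  simp only [repMean, groupConv, toReal_bind_apply, Complex.ofReal_sum, Complex.ofReal_mul,
    sum_smul, mul_smul]
  rw [sum_comm, sum_mul]
  refine sum_congr rfl fun x _ => ?_
  rw [← smul_sum, sum_toReal_map_smul, smul_mul_assoc, mul_sum]
  simp only [map_mul, mul_smul_comm]

theorem repMean_groupConvPow (p : PMF G) (R : G →* Matrix N N ℂ) (k : ℕ) :
    (p.groupConvPow k).repMean R = p.repMean R ^ k := by
  induction k with
  | zero =>
    classical
    simp only [groupConvPow, repMean, pow_zero]
    rw [sum_eq_single 1 (fun g _ hg => by simp [hg]) (by simp)]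
    simp
  | succ k ih => rw [groupConvPow, repMean_groupConv, ih, pow_succ]

theorem repMean_map_inv (p : PMF G) {R : G →* Matrix N N ℂ} (hR : ∀ g, (R g)ᴴ = R g⁻¹) :
    (p.map (·⁻¹)).repMean R = (p.repMean R)ᴴ := by
  rw [repMean, sum_toReal_map_smul, repMean, Matrix.conjTranspose_sum]
  refine sum_congr rfl fun g _ => ?_
  rw [Matrix.conjTranspose_smul, hR]
  simp

theorem norm_repMean_le_one (p : PMF G) {R : G →* Matrix N N ℂ} (hR : ∀ g, (R g)ᴴ = R g⁻¹) :
    ‖p.repMean R‖ ≤ 1 := by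
  rw [← p.sum_toReal]
  refine (norm_sum_le _ _).trans (sum_le_sum fun g _ => ?_)
  rw [norm_smul, Complex.norm_real, Real.norm_of_nonneg ENNReal.toReal_nonneg]
  exact mul_le_of_le_one_right ENNReal.toReal_nonneg (norm_le_one_of_conjTranspose_eq hR g)

/-- Averaging with the reversed distribution replaces the mean by its positive part. -/
theorem norm_pow_le_norm_repMean_groupConvPow (p : PMF G) {R : G →* Matrix N N ℂ}
    (hR : ∀ g, (R g)ᴴ = R g⁻¹) (k : ℕ) (hk : 0 < k) :
    ‖p.repMean R‖ ^ (2 * k) ≤ ‖(((p.map (·⁻¹)).groupConv p).groupConvPow k).repMean R‖ := by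
  rw [repMean_groupConvPow, repMean_groupConv, repMean_map_inv p hR]
  set T := p.repMean R
  set A := Tᴴ * T with hA
  have hAn : ‖A‖ = ‖T‖ ^ 2 := by rw [hA, Matrix.l2_opNorm_conjTranspose_mul_self, sq]
  have hsa : IsSelfAdjoint A := Matrix.isHermitian_conjTranspose_mul_self T
  rw [pow_mul, ← hAn]
  rcases (norm_nonneg A).eq_or_lt with h0 | h0
  · rw [← h0, zero_pow hk.ne']; exact norm_nonneg _
  -- For self-adjoint `A` the norm is exactly multiplicative on powers `2 ^ l`; submultiplicativity
  -- on the remaining `2 ^ l - k` factors then bounds `‖A ^ k‖` from below.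
  obtain ⟨l, hl⟩ : ∃ l, k < 2 ^ l := ⟨k, Nat.lt_two_pow_self⟩
  have h1 : ‖A‖ ^ 2 ^ l = ‖A ^ 2 ^ l‖ := by
    have := hsa.nnnorm_pow_two_pow l
    exact (congrArg NNReal.toReal this).symm
  have h2 : ‖A ^ 2 ^ l‖ ≤ ‖A ^ k‖ * ‖A‖ ^ (2 ^ l - k) := by
    conv_lhs => rw [← Nat.add_sub_cancel' hl.le, pow_add]
    exact (norm_mul_le _ _).trans
      (mul_le_mul_of_nonneg_left (norm_pow_le' _ (by omega)) (norm_nonneg _))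
  rw [← h1, ← Nat.add_sub_cancel' hl.le, pow_add, Nat.add_sub_cancel' hl.le] at h2
  exact le_of_mul_le_mul_right h2 (pow_pos h0 _)

theorem norm_repMean_groupConvPow_le (p : PMF G) {R : G →* Matrix N N ℂ}
    (hR : ∀ g, (R g)ᴴ = R g⁻¹) (k : ℕ) (hk : 0 < k) :
    ‖(((p.map (·⁻¹)).groupConv p).groupConvPow k).repMean R‖ ≤ ‖p.repMean R‖ ^ (2 * k) := by
  rw [repMean_groupConvPow, repMean_groupConv, repMean_map_inv p hR, pow_mul, sq,
    ← Matrix.l2_opNorm_conjTranspose_mul_self]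
  exact norm_pow_le' _ hk

end RepMean

end PMF

/-! ### Fourier inversion for marginals. -/

/-- A family of Schur representations whose characters sum up to the regular character. -/
structure IsRegularFamily {H : Type*} [Group H] [Fintype H] {N : ℕ} {n : Fin N → ℕ}
    (ρ : ∀ j, H →* Matrix (Fin (n j)) (Fin (n j)) ℂ) : Prop where
  pos : ∀ j, 0 < n j
  isSchurRep : ∀ j, IsSchurRep (ρ j)
  sum_trace_of_ne : ∀ h ≠ 1, ∑ j, (ρ j h).trace = 0
  sum_dim : ∑ j, n j = Fintype.card H

/-- The external tensor product of members of a family of representations of `H`, along a selection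
`e` of coordinates of a power of `H`. -/
noncomputable def tensorRep {H : Type*} [Group H] {N : ℕ} {n : Fin N → ℕ}
    (ρ : ∀ j, H →* Matrix (Fin (n j)) (Fin (n j)) ℂ) {ι κ : Type*} [Fintype κ] [DecidableEq κ]
    (e : κ → ι) (j : κ → Fin N) :
    (ι → H) →* Matrix (∀ i, Fin (n (j i))) (∀ i, Fin (n (j i))) ℂ :=
  (piRep fun i => ρ (j i)).comp (restrictHom H e)

theorem exists_isRegularFamily (H : Type*) [Group H] [Fintype H] :
    ∃ (N : ℕ) (n : Fin N → ℕ) (ρ : ∀ j, H →* Matrix (Fin (n j)) (Fin (n j)) ℂ),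
      IsRegularFamily ρ := by
  classical
  obtain ⟨N, n, ρ, hn, hρ, hreg⟩ := exists_isSchurRep_sum_trace H
  refine ⟨N, n, ρ, hn, hρ, fun h hh => by rw [hreg, if_neg hh], ?_⟩
  have := hreg 1
  simp only [map_one, Matrix.trace_one, Fintype.card_fin, if_true] at this
  exact_mod_cast this

namespace IsRegularFamily

variable {H : Type*} [Group H] [Fintype H] {N : ℕ} {n : Fin N → ℕ}
  {ρ : ∀ j, H →* Matrix (Fin (n j)) (Fin (n j)) ℂ}

theorem conjTranspose_tensorRep (hρ : IsRegularFamily ρ) {ι κ : Type*} [Fintype κ] [DecidableEq κ]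
    (e : κ → ι) (j : κ → Fin N) (g : ι → H) :
    (tensorRep ρ e j g)ᴴ = tensorRep ρ e j g⁻¹ := by
  rw [tensorRep, MonoidHom.comp_apply, conjTranspose_piRep _
    fun i => (hρ.isSchurRep (j i)).conjTranspose_apply, MonoidHom.comp_apply,
    map_inv (restrictHom H e)]

theorem dim_eq_one (hρ : IsRegularFamily ρ) {j : Fin N} (hj : ρ j = 1) : n j = 1 := by
  have h := (hρ.isSchurRep j).sum_mul_star ⟨0, hρ.pos j⟩ ⟨0, hρ.pos j⟩ ⟨0, hρ.pos j⟩ ⟨0, hρ.pos j⟩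
  simp only [hj, MonoidHom.one_apply, Matrix.one_apply_eq, star_one, mul_one, sum_const, card_univ,
    nsmul_eq_mul, and_self, if_true, Fintype.card_fin] at h
  have h1 : (Fintype.card H : ℂ) ≠ 0 := Nat.cast_ne_zero.2 Fintype.card_ne_zero
  have h2 : (n j : ℂ) ≠ 0 := Nat.cast_ne_zero.2 (hρ.pos j).ne'
  rw [eq_div_iff h2] at h
  exact_mod_cast mul_left_cancel₀ h1 (h.trans (mul_one _).symm)

theorem trace_eq_one (hρ : IsRegularFamily ρ) {j : Fin N} (hj : ρ j = 1) (h : H) :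
    (ρ j h).trace = 1 := by
  rw [hj, MonoidHom.one_apply, Matrix.trace_one, Fintype.card_fin, hρ.dim_eq_one hj, Nat.cast_one]

open scoped Classical in
theorem sum_trace_eq (hρ : IsRegularFamily ρ) (h : H) :
    ∑ j, (ρ j h).trace = if h = 1 then (Fintype.card H : ℂ) else 0 := by
  split_ifs with hh
  · subst hh
    simp only [map_one, Matrix.trace_one, Fintype.card_fin]
    exact_mod_cast hρ.sum_dim
  · exact hρ.sum_trace_of_ne h hh

/-- Exactly one member of a regular family is trivial. -/
theorem sum_trivial (hρ : IsRegularFamily ρ) [DecidablePred fun j => ρ j = 1] :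
    ∑ j, (if ρ j = 1 then 1 else 0 : ℂ) = 1 := by
  classical
  have h1 : (Fintype.card H : ℂ) ≠ 0 := Nat.cast_ne_zero.2 Fintype.card_ne_zero
  have h2 : ∀ j, ∑ h, (ρ j h).trace = if ρ j = 1 then (Fintype.card H : ℂ) else 0 := by
    intro j
    split_ifs with hj
    · simp [hρ.trace_eq_one hj]
    · rw [← Matrix.trace_sum, (hρ.isSchurRep j).sum_eq_zero hj, Matrix.trace_zero]
  have h3 : ∑ j, ∑ h, (ρ j h).trace = (Fintype.card H : ℂ) := by
    rw [sum_comm]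
    simp [hρ.sum_trace_eq]
  simp only [h2] at h3
  refine mul_left_cancel₀ h1 (Eq.trans ?_ (h3.trans (mul_one _).symm))
  rw [mul_sum]
  simp

section Marginals

variable {ι κ : Type*} [Fintype ι] [DecidableEq ι] [Fintype κ] [DecidableEq κ]

/-- A Fourier coefficient of a marginal is bounded in terms of the mean of the tensor product of its
nontrivial factors. -/
theorem norm_sum_prod_trace_le (hρ : IsRegularFamily ρ) (p : PMF (ι → H)) (e : κ → ι)
    (z : κ → H) {τ : ℝ} (j : κ → Fin N) (s : Finset κ) (hs : ∀ i, i ∉ s → ρ (j i) = 1)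
    (hτ : ‖p.repMean (tensorRep ρ (fun i : s => e i) fun i => j i)‖ ≤ τ) :
    ‖∑ g, ((p g).toReal : ℂ) * ∏ i, (ρ (j i) ((z i)⁻¹ * g (e i))).trace‖ ≤
      (∏ i, (n (j i) : ℝ)) * τ := by
  let R := piRep fun i : s => ρ (j i)
  have h1 : ∀ g : ι → H, ∏ i, (ρ (j i) ((z i)⁻¹ * g (e i))).trace =
      (R (fun i => (z i)⁻¹) * tensorRep ρ (fun i : s => e i) (fun i => j i) g).trace := by
    intro g
    rw [tensorRep, MonoidHom.comp_apply, ← map_mul, trace_piRep]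
    simp only [Pi.mul_apply, restrictHom_apply]
    rw [prod_coe_sort s fun i => (ρ (j i) ((z i)⁻¹ * g (e i))).trace]
    exact (prod_subset (subset_univ s) fun i _ hi => hρ.trace_eq_one (hs i hi) _).symm
  have h2 : ∑ g, ((p g).toReal : ℂ) * ∏ i, (ρ (j i) ((z i)⁻¹ * g (e i))).trace =
      (R (fun i => (z i)⁻¹) *
        p.repMean (tensorRep ρ (fun i : s => e i) fun i => j i)).trace := by
    simp only [h1, PMF.repMean, mul_sum, Matrix.trace_sum, mul_smul_comm, Matrix.trace_smul,
      smul_eq_mul]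
  have h3 : (Fintype.card (∀ i : s, Fin (n (j i))) : ℝ) = ∏ i, (n (j i) : ℝ) := by
    rw [Fintype.card_pi, Nat.cast_prod]
    simp only [Fintype.card_fin]
    rw [prod_coe_sort s fun i => (n (j i) : ℝ)]
    exact prod_subset (subset_univ s) fun i _ hi => by rw [hρ.dim_eq_one (hs i hi), Nat.cast_one]
  rw [h2]
  refine (Matrix.norm_trace_le_card_mul_norm _).trans ?_
  rw [h3]
  refine mul_le_mul_of_nonneg_left ?_ (by positivity)
  refine (norm_mul_le _ _).trans ((mul_le_of_le_one_left (norm_nonneg _) ?_).trans hτ)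
  exact norm_le_one_of_conjTranspose_eq (conjTranspose_piRep _
    fun i => (hρ.isSchurRep _).conjTranspose_apply) _

/-- Pointwise bound for a marginal of a distribution on a power of `H` by Fourier inversion. -/
theorem abs_marginal_sub_le [DecidableEq H] (hρ : IsRegularFamily ρ) (p : PMF (ι → H)) (e : κ → ι) (z : κ → H)
    {τ : ℝ} (hτ0 : 0 ≤ τ)
    (hτ : ∀ s : Finset κ, s.Nonempty → ∀ j : κ → Fin N, (∀ i ∈ s, ρ (j i) ≠ 1) →
      ‖p.repMean (tensorRep ρ (fun i : s => e i) fun i => j i)‖ ≤ τ) :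
    |(Fintype.card H : ℝ) ^ Fintype.card κ * ∑ g with ∀ i, g (e i) = z i, (p g).toReal - 1| ≤
      (Fintype.card H : ℝ) ^ Fintype.card κ * τ := by
  classical
  let c : (κ → Fin N) → ℂ := fun j =>
    ∑ g, ((p g).toReal : ℂ) * ∏ i, (ρ (j i) ((z i)⁻¹ * g (e i))).trace
  -- `a` singles out the all-trivial term, which supplies the main term 1. Every other `c j` is a
  -- Fourier coefficient on the nonempty set of nontrivial factors.
  let a : (κ → Fin N) → ℂ := fun j => ∏ i, if ρ (j i) = 1 then 1 else 0
  have hc : ∑ j, c j = (Fintype.card H : ℂ) ^ Fintype.card κ *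
      ∑ g with ∀ i, g (e i) = z i, ((p g).toReal : ℂ) := by
    simp only [c]
    rw [sum_comm, sum_filter, mul_sum]
    refine sum_congr rfl fun g _ => ?_
    rw [← mul_sum, ← Fintype.prod_sum fun i k => (ρ k ((z i)⁻¹ * g (e i))).trace]
    simp only [hρ.sum_trace_eq, inv_mul_eq_one]
    split_ifs with h
    · simp [h, mul_comm]
    · push Not at h
      obtain ⟨i, hi⟩ := h
      rw [prod_eq_zero (mem_univ i) (if_neg fun h => hi h.symm)]
      simp
  have ha : ∑ j, a j = 1 := by
    simp only [a]
    rw [← Fintype.prod_sum fun (_ : κ) k => if ρ k = 1 then (1 : ℂ) else 0]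
    simp [hρ.sum_trivial]
  have hterm : ∀ j, ‖c j - a j‖ ≤ (∏ i, (n (j i) : ℝ)) * τ := by
    intro j
    by_cases hj : ∀ i, ρ (j i) = 1
    · have h1 : c j = 1 := by
        simp only [c, hρ.trace_eq_one (hj _), prod_const_one, mul_one]
        exact_mod_cast p.sum_toReal
      have h2 : a j = 1 := by simp [a, hj]
      rw [h1, h2, sub_self, norm_zero]
      positivity
    · push Not at hj
      obtain ⟨i, hi⟩ := hj
      have h2 : a j = 0 := prod_eq_zero (mem_univ i) (if_neg hi)
      rw [h2, sub_zero]
      refine hρ.norm_sum_prod_trace_le p e z j (univ.filter fun i => ρ (j i) ≠ 1)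
        (fun i hi => by simpa using hi) (hτ _ ⟨i, by simpa using hi⟩ j fun i hi => ?_)
      simpa using hi
  have hsum : ∑ j : κ → Fin N, ∏ i, (n (j i) : ℝ) = (Fintype.card H : ℝ) ^ Fintype.card κ := by
    rw [← Fintype.prod_sum fun (_ : κ) k => (n k : ℝ), prod_const, card_univ, ← hρ.sum_dim]
    push_cast
    rfl
  have hfin : (((Fintype.card H : ℝ) ^ Fintype.card κ *
      ∑ g with ∀ i, g (e i) = z i, (p g).toReal - 1 : ℝ) : ℂ) = ∑ j, (c j - a j) := by
    rw [sum_sub_distrib, hc, ha]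
    push_cast
    rfl
  rw [← Real.norm_eq_abs, ← Complex.norm_real, hfin]
  refine (norm_sum_le _ _).trans ((sum_le_sum fun j _ => hterm j).trans_eq ?_)
  rw [← sum_mul, hsum]

end Marginals

end IsRegularFamily

/-! ### Vanishing of low-degree coefficients under uniformity. -/

theorem repMean_tensorRep_eq_zero_of_marginal {H : Type*} [Group H] [Fintype H] {N : ℕ}
    {n : Fin N → ℕ} {ρ : ∀ j, H →* Matrix (Fin (n j)) (Fin (n j)) ℂ} (hρ : IsRegularFamily ρ)
    {ι κ : Type*} [Fintype ι] [DecidableEq ι] [Fintype κ] [DecidableEq κ] (p : PMF (ι → H))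
    (I : Finset ι) (C : ℝ) (hp : ∀ y, (p.map (fun x (i : I) => x i) y).toReal = C)
    (e : κ → ι) (he : Function.Injective e) (heI : ∀ i, e i ∈ I) (j : κ → Fin N) (i₀ : κ)
    (hj : ρ (j i₀) ≠ 1) : p.repMean (tensorRep ρ e j) = 0 := by
  let e' : κ → I := fun i => ⟨e i, heI i⟩
  have he' : Function.Injective e' := fun a b h => he (congrArg Subtype.val h)
  let R := tensorRep ρ e' j
  have h1 : p.repMean (tensorRep ρ e j) = (C : ℂ) • ∑ y, R y := by
    rw [smul_sum]
    refine Eq.trans ?_ (Finset.sum_congr rfl fun y _ => by rw [← hp y])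
    rw [PMF.sum_toReal_map_smul]
    rfl
  -- The sum of `R` over the power group is invariant under translation in the single coordinate `e'
  -- i₀`, but averaging the nontrivial `ρ (j i₀)` over that coordinate gives zero.
  let ins : H → (I → H) := fun h => Pi.mulSingle (e' i₀) h
  have h2 : ∀ h, R (ins h) * ∑ y, R y = ∑ y, R y := fun h => by
    rw [mul_sum]
    simp_rw [← map_mul]
    exact Fintype.sum_equiv (Equiv.mulLeft (ins h)) _ _ fun _ => rfl
  have h3 : ∑ h, R (ins h) = 0 := by
    ext a b
    rw [Matrix.sum_apply, Matrix.zero_apply]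
    have h4 : ∀ h, R (ins h) a b =
        ρ (j i₀) h (a i₀) (b i₀) * ∏ i ∈ univ.erase i₀, (1 : Matrix _ _ ℂ) (a i) (b i) := by
      intro h
      change ∏ i, ρ (j i) (ins h (e' i)) (a i) (b i) = _
      rw [← mul_prod_erase univ _ (mem_univ i₀)]
      congr 1
      · simp [ins]
      · refine prod_congr rfl fun i hi => ?_
        have : e' i ≠ e' i₀ := fun h => (mem_erase.1 hi).1 (he' h)
        simp [ins, Pi.mulSingle_eq_of_ne this]
    simp only [h4, ← sum_mul]
    rw [← Matrix.sum_apply, (hρ.isSchurRep _).sum_eq_zero hj, Matrix.zero_apply, zero_mul]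
  have h5 : (Fintype.card H : ℂ) • ∑ y, R y = 0 := by
    calc _ = ∑ h, R (ins h) * ∑ y, R y := by
          simp only [h2, sum_const, card_univ, Nat.cast_smul_eq_nsmul]
      _ = 0 := by rw [← sum_mul, h3, zero_mul]
  rw [h1, (smul_eq_zero.1 h5).resolve_left (Nat.cast_ne_zero.2 Fintype.card_ne_zero), smul_zero]

theorem repMean_eq_zero_of_isKUniform {H : Type*} [Group H] [Fintype H] {N : ℕ}
    {n : Fin N → ℕ} {ρ : ∀ j, H →* Matrix (Fin (n j)) (Fin (n j)) ℂ} (hρ : IsRegularFamily ρ)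
    {m k : ℕ} {κ : Type*} [Fintype κ] [DecidableEq κ] {p : PMF (Fin m → H)} (hp : p.IsKUniform k)
    (e : κ → Fin m) (he : Function.Injective e) (hκ : Fintype.card κ ≤ k) (j : κ → Fin N) (i₀ : κ)
    (hj : ρ (j i₀) ≠ 1) : p.repMean (tensorRep ρ e j) = 0 := by
  obtain ⟨hkm, hp⟩ := hp
  obtain ⟨I, hI, hIk⟩ := Finset.exists_superset_card_eq (s := univ.image e) (n := k)
    ((card_image_le).trans hκ) (by simpa using hkm)
  refine repMean_tensorRep_eq_zero_of_marginal hρ p I (1 / Nat.card (I → H)) (fun y => ?_) e he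
    (fun i => hI (mem_image_of_mem _ (mem_univ i))) j i₀ hj
  have := hp I hIk y
  rw [zero_div] at this
  exact sub_eq_zero.1 (abs_nonpos_iff.1 this)

/-! ### The induction on the number of coordinates. -/

/-- Squaring absorbs the constant, since `(9 / 8) ^ 8 < 4 ≤ d`, and a 12th power reaches `h ^ a`.
The total exponent `2 * 4 * 2 * 12 * k * M = 192 * k * M` is at most `576 * M * a` because `k ≤ 3 *
a`. -/
theorem pow_le_inv_of_tripartite {t h d : ℝ} {a k M : ℕ} (ht0 : 0 ≤ t) (ht1 : t ≤ 1) (hh : 0 < h)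
    (hd : 4 ≤ d) (ha : 0 < a) (hk : k ≤ 3 * a) (hdh : h ^ a ≤ d ^ 12)
    (ht : (t ^ (2 * (k * M))) ^ 4 ≤ (9 / 8) ^ 4 / d) : t ^ (576 * M) ≤ h⁻¹ := by
  have hd0 : 0 < d := by linarith
  have h1 : ((t ^ (2 * (k * M))) ^ 4) ^ 2 ≤ d⁻¹ := by
    refine (pow_le_pow_left₀ (by positivity) ht 2).trans ?_
    rw [div_pow, inv_eq_one_div, div_le_div_iff₀ (by positivity) hd0]
    nlinarith
  have h2 : (t ^ (576 * M)) ^ a ≤ h⁻¹ ^ a := by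
    calc (t ^ (576 * M)) ^ a = t ^ (576 * M * a) := by rw [← pow_mul]
      _ ≤ t ^ (2 * (k * M) * 4 * 2 * 12) := by
          refine pow_le_pow_of_le_one ht0 ht1 ?_
          nlinarith [Nat.mul_le_mul_right M hk]
      _ = (((t ^ (2 * (k * M))) ^ 4) ^ 2) ^ 12 := by simp only [← pow_mul]
      _ ≤ d⁻¹ ^ 12 := pow_le_pow_left₀ (by positivity) h1 12
      _ ≤ h⁻¹ ^ a := by
          rw [inv_pow, inv_pow]
          exact inv_anti₀ (by positivity) hdh
  exact le_of_pow_le_pow_left₀ ha.ne' (by positivity) h2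

theorem mul_pow_le_pow_of_five_mul_le {k s : ℕ} (h : 5 * k ≤ 4 * s) : 576 * k ^ 33 ≤ s ^ 33 := by
  have h1 : (5 * k) ^ 33 ≤ (4 * s) ^ 33 := Nat.pow_le_pow_left h 33
  rw [mul_pow, mul_pow] at h1
  have h2 : (4 : ℕ) ^ 33 * 576 ≤ 5 ^ 33 := by norm_num
  refine Nat.le_of_mul_le_mul_left (c := 5 ^ 33) ?_ (Nat.pow_pos (by norm_num))
  calc 5 ^ 33 * (576 * k ^ 33) = 576 * (5 ^ 33 * k ^ 33) := by ring
    _ ≤ 576 * (4 ^ 33 * s ^ 33) := Nat.mul_le_mul_left _ h1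
    _ = (4 ^ 33 * 576) * s ^ 33 := by ring
    _ ≤ 5 ^ 33 * s ^ 33 := Nat.mul_le_mul_right _ h2

section Growth

variable {H : Type*} [Group H] [Fintype H] {N : ℕ} {n : Fin N → ℕ}
  {ρ : ∀ j, H →* Matrix (Fin (n j)) (Fin (n j)) ℂ}
  {ι : Type*} [Fintype ι] [DecidableEq ι]

/-- Distributions whose Fourier coefficients supported on pairs of blocks are tiny have small
Fourier coefficients on the union of three blocks. -/
theorem norm_repMean_tensorRep_pow_four_le [DecidableEq H] (hρ : IsRegularFamily ρ) (r : PMF (ι → H))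
    {κ α β γ : Type} [Fintype κ] [DecidableEq κ] [Fintype α] [DecidableEq α]
    [Fintype β] [DecidableEq β] [Fintype γ] [DecidableEq γ]
    (φ : α ⊕ (β ⊕ γ) ≃ κ) (e : κ → ι) (j : κ → Fin N) {K : ℝ} (hK : 0 ≤ K)
    (hαβ : ∀ z : α ⊕ β → H, ∑ g with ∀ i, g (e (φ (Sum.elim .inl (.inr ∘ .inl) i))) = z i,
      (r g).toReal ≤ K / (Fintype.card H : ℝ) ^ Fintype.card (α ⊕ β))
    (hαγ : ∀ z : α ⊕ γ → H, ∑ g with ∀ i, g (e (φ (Sum.elim .inl (.inr ∘ .inr) i))) = z i,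
      (r g).toReal ≤ K / (Fintype.card H : ℝ) ^ Fintype.card (α ⊕ γ))
    (hβγ : ∀ z : β ⊕ γ → H, ∑ g with ∀ i, g (e (φ (.inr i))) = z i,
      (r g).toReal ≤ K / (Fintype.card H : ℝ) ^ Fintype.card (β ⊕ γ)) :
    ‖r.repMean (tensorRep ρ e j)‖ ^ 4 ≤ K ^ 4 / ∏ i : α, (n (j (φ (.inl i))) : ℝ) := by
  let eA : α → ι := fun i => e (φ (.inl i))
  let eB : β → ι := fun i => e (φ (.inr (.inl i)))
  let eC : γ → ι := fun i => e (φ (.inr (.inr i)))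
  let σA := piRep fun i : α => ρ (j (φ (.inl i)))
  let σB := piRep fun i : β => ρ (j (φ (.inr (.inl i))))
  let σC := piRep fun i : γ => ρ (j (φ (.inr (.inr i))))
  have key := norm_sum_smul_pow_four_le (tensorRep ρ e j) (hρ.conjTranspose_tensorRep e j)
    (restrictHom H eA) (restrictHom H eB) (restrictHom H eC)
    (σ := σA) (IsSchurRep.piRep fun i => hρ.isSchurRep _)
    (fun x => (σB x).trace) (fun x => (σC x).trace)
    (IsSchurRep.piRep fun i => hρ.isSchurRep _).sum_norm_trace_sq_le
    (IsSchurRep.piRep fun i => hρ.isSchurRep _).sum_norm_trace_sq_le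
    (fun g => ?_) (fun g => (r g).toReal) (fun g => ENNReal.toReal_nonneg) hK
    (fun x y => ?_) (fun x y => ?_) (fun x y => ?_)
  · have hc : (Fintype.card (∀ i : α, Fin (n (j (φ (.inl i))))) : ℝ) =
        ∏ i : α, (n (j (φ (.inl i))) : ℝ) := by simp [Fintype.card_pi]
    rw [hc] at key
    exact key
  · rw [tensorRep, MonoidHom.comp_apply, trace_piRep, trace_piRep, trace_piRep, trace_piRep,
      ← Fintype.prod_equiv φ (fun i => (ρ (j (φ i)) (restrictHom H e g (φ i))).trace) _
        fun _ => rfl, Fintype.prod_sum_type, Fintype.prod_sum_type, mul_assoc]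
    rfl
  · have := hαβ (Sum.elim x y)
    simp only [Fintype.card_sum, pow_add] at this
    simpa [funext_iff, eA, eB] using this
  · have := hαγ (Sum.elim x y)
    simp only [Fintype.card_sum, pow_add] at this
    simpa [funext_iff, eA, eC] using this
  · have := hβγ (Sum.elim x y)
    simp only [Fintype.card_sum, pow_add] at this
    simpa [funext_iff, eB, eC] using this

/-- Polynomial spectral gap for a distribution on a power of `H` all of whose Fourier coefficients
on at most three coordinates vanish. -/
theorem norm_repMean_pow_le (hρ : IsRegularFamily ρ) (hH : 1 < Fintype.card H)
    (hdim : ∀ j, ρ j ≠ 1 → 2 ≤ n j ∧ Fintype.card H ≤ n j ^ 12) (p : PMF (ι → H))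
    (hp : ∀ (κ : Type) [Fintype κ] [DecidableEq κ] (e : κ → ι), Function.Injective e →
      1 ≤ Fintype.card κ → Fintype.card κ ≤ 3 → ∀ j : κ → Fin N, (∀ i, ρ (j i) ≠ 1) →
      p.repMean (tensorRep ρ e j) = 0) (s : ℕ) :
    ∀ (κ : Type) [Fintype κ] [DecidableEq κ] (e : κ → ι), Function.Injective e →
      Fintype.card κ = s → 1 ≤ s → ∀ j : κ → Fin N, (∀ i, ρ (j i) ≠ 1) →
      ‖p.repMean (tensorRep ρ e j)‖ ^ s ^ 33 ≤ (Fintype.card H : ℝ)⁻¹ := by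
  classical
  induction s using Nat.strong_induction_on with
  | _ s ih =>
  intro κ _ _ e he hκ hs j hj
  have hH0 : (0 : ℝ) < Fintype.card H := by exact_mod_cast hH.le
  have hH2 : (2 : ℝ) ≤ Fintype.card H := by exact_mod_cast hH
  rcases Nat.lt_or_ge 3 s with hs3 | hs3
  swap
  · rw [hp κ e he (hκ ▸ hs) (hκ ▸ hs3) j hj, norm_zero, zero_pow (by positivity)]
    positivity
  -- Blocks of sizes `a`, `b`, `b` with `a ≥ b`, so two of them have at most `k = a + b` elements.
  -- For `s > 3` this is at most `4 * s / 5`, with equality at `s = 5`.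
  obtain ⟨b, hb⟩ : ∃ b, b = s / 3 := ⟨_, rfl⟩
  obtain ⟨a, ha⟩ : ∃ a, a = s - 2 * b := ⟨_, rfl⟩
  obtain ⟨k, hk⟩ : ∃ k, k = s - b := ⟨_, rfl⟩
  obtain ⟨M, hM⟩ : ∃ M, M = k ^ 33 := ⟨_, rfl⟩
  have hkM : 0 < k * M := by
    have : 0 < k := by omega
    rw [hM]
    positivity
  -- The exponent `M` brings coefficients on at most `k` coordinates below `h⁻¹`; the extra factor
  -- `k`, doubled by the reversal, gives `h⁻¹ ^ (2 * k)`, which beats the loss `h ^ k` of Fourier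
  -- inversion.
  let r := ((p.map (·⁻¹)).groupConv p).groupConvPow (k * M)
  -- Fourier coefficients of `r` on at most `k` coordinates are tiny.
  have hr : ∀ (κ' : Type) [Fintype κ'] [DecidableEq κ'] (e' : κ' → ι), Function.Injective e' →
      1 ≤ Fintype.card κ' → Fintype.card κ' ≤ k → ∀ j : κ' → Fin N, (∀ i, ρ (j i) ≠ 1) →
      ‖r.repMean (tensorRep ρ e' j)‖ ≤ (Fintype.card H : ℝ)⁻¹ ^ (2 * k) := by
    intro κ' _ _ e' he' h1 h2 j' hj'
    have hU := hρ.conjTranspose_tensorRep e' j'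
    refine (p.norm_repMean_groupConvPow_le hU _ hkM).trans ?_
    have h3 := ih _ (by omega : Fintype.card κ' < s) κ' e' he' rfl h1 j' hj'
    have h4 : ‖p.repMean (tensorRep ρ e' j')‖ ^ M ≤ (Fintype.card H : ℝ)⁻¹ :=
      (pow_le_pow_of_le_one (norm_nonneg _) (p.norm_repMean_le_one hU)
        (hM ▸ Nat.pow_le_pow_left h2 33)).trans h3
    calc _ = (‖p.repMean (tensorRep ρ e' j')‖ ^ M) ^ (2 * k) := by
          rw [← pow_mul]; congr 1; ring
      _ ≤ _ := pow_le_pow_left₀ (by positivity) h4 _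
  -- Hence so are the deviations of its marginals.
  have hmarg : ∀ (κ' : Type) [Fintype κ'] [DecidableEq κ'] (e' : κ' → ι), Function.Injective e' →
      Fintype.card κ' ≤ k → ∀ z : κ' → H, ∑ g with ∀ i, g (e' i) = z i, (r g).toReal ≤
        (9 / 8) / (Fintype.card H : ℝ) ^ Fintype.card κ' := by
    intro κ' _ _ e' he' h2 z
    have h3 := hρ.abs_marginal_sub_le r e' z (τ := (Fintype.card H : ℝ)⁻¹ ^ (2 * k))
      (by positivity) fun t ht j' hj' =>
        hr t _ (he'.comp Subtype.val_injective) (by simpa using ht.card_pos)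
          ((Fintype.card_coe t).trans_le ((card_le_univ t).trans h2)) _ fun i => hj' i i.2
    have h4 : (Fintype.card H : ℝ) ^ Fintype.card κ' * (Fintype.card H : ℝ)⁻¹ ^ (2 * k) ≤ 1 / 8 := by
      calc _ ≤ (Fintype.card H : ℝ) ^ k * (Fintype.card H : ℝ)⁻¹ ^ (2 * k) := by
            gcongr
            linarith
        _ = ((Fintype.card H : ℝ) ^ k)⁻¹ := by
            rw [two_mul, pow_add, inv_pow]; field_simp
        _ ≤ ((8 : ℝ))⁻¹ := by
            refine inv_anti₀ (by norm_num) ?_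
            calc (8 : ℝ) = 2 ^ 3 := by norm_num
              _ ≤ 2 ^ k := pow_le_pow_right₀ (by norm_num) (by omega)
              _ ≤ _ := pow_le_pow_left₀ (by norm_num) hH2 k
        _ = _ := by norm_num
    rw [le_div_iff₀ (by positivity), mul_comm]
    linarith [(abs_le.1 h3).2]
  have hcard : Fintype.card (Fin a ⊕ (Fin b ⊕ Fin b)) = Fintype.card κ := by
    simp only [Fintype.card_sum, Fintype.card_fin]
    omega
  let φ := Fintype.equivOfCardEq hcard
  have hinj : ∀ {κ' : Type} {f : κ' → Fin a ⊕ (Fin b ⊕ Fin b)}, Function.Injective f →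
      Function.Injective fun i => e (φ (f i)) := fun hf => he.comp (φ.injective.comp hf)
  have htri := norm_repMean_tensorRep_pow_four_le hρ r φ e j (K := 9 / 8) (by norm_num)
    (hmarg (Fin a ⊕ Fin b) _ (hinj (Sum.inl_injective.sumElim
      (Sum.inr_injective.comp Sum.inl_injective) (by simp)))
      (by simp only [Fintype.card_sum, Fintype.card_fin]; omega))
    (hmarg (Fin a ⊕ Fin b) _ (hinj (Sum.inl_injective.sumElim
      (Sum.inr_injective.comp Sum.inr_injective) (by simp)))
      (by simp only [Fintype.card_sum, Fintype.card_fin]; omega))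
    (hmarg (Fin b ⊕ Fin b) _ (hinj Sum.inr_injective)
      (by simp only [Fintype.card_sum, Fintype.card_fin]; omega))
  have hU := hρ.conjTranspose_tensorRep e j
  have h1 := p.norm_pow_le_norm_repMean_groupConvPow hU _ hkM
  set d : ℝ := ∏ i : Fin a, (n (j (φ (.inl i))) : ℝ) with hd
  have hd4 : 4 ≤ d := by
    calc (4 : ℝ) = 2 ^ 2 := by norm_num
      _ ≤ 2 ^ a := pow_le_pow_right₀ (by norm_num) (by omega)
      _ = ∏ _i : Fin a, (2 : ℝ) := by simp
      _ ≤ d := prod_le_prod (fun _ _ => by norm_num) fun i _ => by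
          exact_mod_cast (hdim _ (hj _)).1
  have hdH : (Fintype.card H : ℝ) ^ a ≤ d ^ 12 := by
    calc (Fintype.card H : ℝ) ^ a = ∏ _i : Fin a, (Fintype.card H : ℝ) := by simp
      _ ≤ ∏ i : Fin a, (n (j (φ (.inl i))) : ℝ) ^ 12 :=
          prod_le_prod (fun _ _ => hH0.le) fun i _ => by exact_mod_cast (hdim _ (hj _)).2
      _ = d ^ 12 := by rw [prod_pow]
  have h4 := (pow_le_pow_left₀ (pow_nonneg (norm_nonneg _) _) h1 4).trans htri
  have h2 := pow_le_inv_of_tripartite (k := k) (M := M) (a := a) (norm_nonneg _)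
    (p.norm_repMean_le_one hU) hH0 hd4 (by omega) (by omega) hdH h4
  have h3 : 576 * M ≤ s ^ 33 := hM ▸ mul_pow_le_pow_of_five_mul_le (by omega)
  exact (pow_le_pow_of_le_one (norm_nonneg _) (p.norm_repMean_le_one hU) h3).trans h2

end Growth

/-! ### Conclusion. -/

theorem theorem2 :
    ∃ c : ℕ, ∀ (F : Type*) [Field F] [Finite F], 4 ≤ Nat.card F →
      ∀ (m : ℕ) (p : PMF (Fin m → SL(2, F))), PMF.IsKUniform 3 p →
        PMF.IsEpsUniform (((Nat.card SL(2, F) : ℝ) ^ m)⁻¹) (p.groupConvPow (m ^ c)) := by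
  classical
  -- Here 35 = 33 + 2: `m ^ 33` factors bring each coefficient to `h⁻¹`, and `m ^ 2 ≥ 2 * m`
  -- repetitions to `h⁻¹ ^ (2 * m)`, half of which pays for Fourier inversion on all `m`
  -- coordinates.
  refine ⟨35, fun F _ _ hF m p hp x => ?_⟩
  have := Fintype.ofFinite F
  have hm : 3 ≤ m := hp.1
  rw [Nat.card_eq_fintype_card] at hF
  obtain ⟨N, n, ρ, hρ⟩ := exists_isRegularFamily SL(2, F)
  have hdim : ∀ j, ρ j ≠ 1 → 2 ≤ n j ∧ Fintype.card SL(2, F) ≤ n j ^ 12 := fun j hj => by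
    simpa using card_le_pow_of_ne_one hF (ρ j) (hρ.isSchurRep j).conjTranspose_apply hj
  have hH : 1 < Fintype.card SL(2, F) := by
    refine Fintype.one_lt_card_iff.2 ⟨1, Matrix.SpecialLinearGroup.transvection zero_ne_one 1, ?_⟩
    intro h
    have := congrFun (congrFun (congrArg Subtype.val h) 0) 1
    simp [Matrix.SpecialLinearGroup.transvection_coe] at this
  have hgap := norm_repMean_pow_le hρ hH hdim p fun κ _ _ e he h1 h3 j hj => by
    obtain ⟨i₀⟩ := Fintype.card_pos_iff.1 h1
    exact repMean_eq_zero_of_isKUniform hρ hp e he h3 j i₀ (hj i₀)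
  set h : ℝ := (Fintype.card SL(2, F) : ℝ) with hh
  have hh0 : 0 < h := by rw [hh]; exact_mod_cast hH.le
  have hmain := hρ.abs_marginal_sub_le (p.groupConvPow (m ^ 35)) (id : Fin m → Fin m) x
    (τ := h⁻¹ ^ (2 * m)) (by positivity) fun s hs j hj => by
      have hU := hρ.conjTranspose_tensorRep (fun i : s => id (i : Fin m)) fun i => j i
      have h1 := hgap _ s (fun i => id (i : Fin m)) Subtype.val_injective rfl
        (by simpa using hs.card_pos) (fun i => j i) fun i => hj i i.2
      rw [PMF.repMean_groupConvPow]
      have hsm : Fintype.card s ≤ m := by simpa using card_le_univ s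
      set t := ‖p.repMean (tensorRep ρ (fun i : s => id (i : Fin m)) fun i => j i)‖ with ht
      have ht1 : t ≤ 1 := p.norm_repMean_le_one hU
      calc _ ≤ t ^ m ^ 35 := norm_pow_le' _ (by positivity)
        _ ≤ t ^ (m ^ 33 * (2 * m)) := by
            refine pow_le_pow_of_le_one (norm_nonneg _) ht1 ?_
            calc m ^ 33 * (2 * m) ≤ m ^ 33 * (m * m) := by gcongr; omega
              _ = m ^ 35 := by ring
        _ = (t ^ m ^ 33) ^ (2 * m) := by rw [pow_mul]
        _ ≤ h⁻¹ ^ (2 * m) := by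
            refine pow_le_pow_left₀ (by positivity) ?_ _
            exact (pow_le_pow_of_le_one (norm_nonneg _) ht1 (Nat.pow_le_pow_left hsm 33)).trans h1
  simp only [id_eq] at hmain
  rw [sum_filter, sum_eq_single x (fun g _ hg => if_neg fun h => hg (funext h)) (by simp),
    if_pos fun _ => rfl, Fintype.card_fin, ← hh] at hmain
  have hcard : (Nat.card (Fin m → SL(2, F)) : ℝ) = h ^ m := by
    rw [Nat.card_eq_fintype_card]; simp [hh]
  rw [hcard, Nat.card_eq_fintype_card, ← hh]
  have hhm : 0 < h ^ m := by positivity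
  set P := (p.groupConvPow (m ^ 35) x).toReal
  have h5 : P - 1 / h ^ m = (h ^ m * P - 1) / h ^ m := by field_simp
  rw [h5, abs_div, abs_of_pos hhm]
  gcongr
  refine hmain.trans_eq ?_
  rw [two_mul, pow_add, inv_pow]
  field_simp
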